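/- Let $M$ be a paracompact smooth manifold of finite dimension, $\pi:\mathcal TM\to M$ the bundle of nonzero tangent vectors, and $\pi^{-1}(TM)\to\mathcal TM$ the pullback of $TM$; smooth sections of $\pi^{-1}(TM)$ are called $\pi$-vector fields. Let $\rho=(\pi_{\mathcal TM},d\pi):T\mathcal TM\to\pi^{-1}(TM)$, let $\gamma:\pi^{-1}(TM)\to T\mathcal TM$ be the vertical lift, and let $\overline\eta(u)=(u,u)$ be the fundamental $\pi$-vector field. A Finsler structure is a continuous function $L:TM\to\mathbb R$ which is smooth and positive on $\mathcal TM$, positively homogeneous of degree one on each tangent space, and whose metric on $\pi^{-1}(TM)$, $g_u(v,w)=\frac12\frac{\partial^2}{\partial s\,\partial t}L^2(u+sv+tw)|_{s=t=0}$, is positive definite. A smooth linear connection $D$ on $\pi^{-1}(TM)$ is regular if $T_u\mathcal TM=\ker\rho_u\oplus\ker(X\mapsto D_X\overline\eta)_u$ for all $u\in\mathcal TM$; its horizontal map $\beta$ is then the inverse of the restriction of $\rho$ to the horizontal spaces $\ker(X\mapsto D_X\overline\eta)$. Put $\mathbf T(X,Y)=D_X\rho Y-D_Y\rho X-\rho[X,Y]$.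 The Cartan connection of $(M,L)$ is the regular connection $\nabla$ on $\pi^{-1}(TM)$ such that $\nabla g=0$, $\mathbf T(\beta\overline X,\beta\overline Y)=0$, and $T(\overline X,\overline Y):=\mathbf T(\gamma\overline X,\beta\overline Y)$ satisfies $g(T(\overline X,\overline Y),\overline Z)=g(T(\overline X,\overline Z),\overline Y)$. Let $(M,L)$ be a Finsler manifold with Cartan connection $\nabla$ and let $\overline\zeta$ be a concurrent $\pi$-vector field, i.e. $\nabla_X\overline\zeta=-\rho X$ for all $X$. Put $B=g(\overline\zeta,\overline\eta)$ and $p^2=g(\overline\zeta,\overline\zeta)$, and let $(M,\widetilde L)$ be a Finsler manifold, with Cartan connection $\widetilde\nabla$, such that $\widetilde L^2=L^2+B^2$ on $\mathcal TM$. Then for all vector fields $X,Y$ on $\mathcal TM$ $$\widetilde\nabla_X\rho Y=\nabla_X\rho Y-\frac{g(\rho X,\rho Y)}{1+p^2}\,\overline\zeta .$$ In particular, for all $\pi$-vector fields $\overline X,\overline Y$, (a) $\widetilde\nabla_{\gamma\overline X}\overline Y=\nabla_{\gamma\overline X}\overline Y$; (b) $\widetilde\nabla_{\widetilde\beta\overline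 X}\overline Y=\nabla_{\beta\overline X}\overline Y-U(\overline X,\overline Y)$, where $U(\overline X,\overline Y)=\dfrac{g(\overline X,\overline Y)}{1+p^2}\,\overline\zeta-\dfrac{g(\overline X,\overline\eta)}{1+p^2}\,\nabla_{\gamma\overline\zeta}\overline Y$, and $\beta,\widetilde\beta$ are the horizontal maps of $\nabla,\widetilde\nabla$. -/

import Mathlib

open Bundle Manifold
open scoped Manifold ContDiff Topology

noncomputable section

namespace Finsler

variable {E : Type*} [NormedAddCommGroup E] [NormedSpace ℝ E]
  {M : Type*} [TopologicalSpace M] [ChartedSpace E M] [IsManifold 𝓘(ℝ, E) ∞ M]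

/-! ### The slit tangent bundle and the pullback bundle -/

variable (E M) in
/-- The projection `TM → M`, as a smooth map. -/
def projTM : C^∞⟮𝓘(ℝ, E).tangent, TangentBundle 𝓘(ℝ, E) M; 𝓘(ℝ, E), M⟯ :=
  ⟨TotalSpace.proj, contMDiff_proj (TangentSpace 𝓘(ℝ, E) : M → Type _)⟩

variable (E M) in
/-- The pullback of the tangent bundle by the projection `π : TM → M`; its fibre over `u` is
`T_{π u} M`. Only its restriction to the slit tangent bundle matters below. -/
abbrev PiTM : TangentBundle 𝓘(ℝ, E) M → Type _ :=
  (projTM E M) *ᵖ (TangentSpace 𝓘(ℝ, E) : M → Type _)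

instance instAddCommGroupPiTM (u : TangentBundle 𝓘(ℝ, E) M) : AddCommGroup (PiTM E M u) :=
  inferInstanceAs (AddCommGroup (TangentSpace 𝓘(ℝ, E) u.proj))

instance instIsTopologicalAddGroupPiTM (u : TangentBundle 𝓘(ℝ, E) M) :
    IsTopologicalAddGroup (PiTM E M u) :=
  inferInstanceAs (IsTopologicalAddGroup (TangentSpace 𝓘(ℝ, E) u.proj))

instance instContinuousSMulPiTM (u : TangentBundle 𝓘(ℝ, E) M) :
    ContinuousSMul ℝ (PiTM E M u) :=
  inferInstanceAs (ContinuousSMul ℝ (TangentSpace 𝓘(ℝ, E) u.proj))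

variable (E M) in
/-- The set of nonzero tangent vectors. Vector fields, `π`-vector fields and connections are
represented by objects defined over all of `TM`, whose values on the zero section are irrelevant:
conditions are imposed, and conclusions are drawn, on the slit tangent bundle only. -/
def slit : Set (TangentBundle 𝓘(ℝ, E) M) := {u | u.2 ≠ 0}

/-- `Y` is a smooth `π`-vector field: a smooth section of the pullback bundle over the slit tangent
bundle. -/
def IsSmoothPiField (Y : Π u : TangentBundle 𝓘(ℝ, E) M, PiTM E M u) : Prop :=
  ContMDiffOn 𝓘(ℝ, E).tangent (𝓘(ℝ, E).tangent.prod 𝓘(ℝ, E)) ∞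
    (fun u ↦ (⟨u, Y u⟩ : TotalSpace E (PiTM E M))) (slit E M)

/-- `X` is a smooth vector field on the slit tangent bundle. -/
def IsSmoothField (X : Π u : TangentBundle 𝓘(ℝ, E) M, TangentSpace 𝓘(ℝ, E).tangent u) : Prop :=
  ContMDiffOn 𝓘(ℝ, E).tangent 𝓘(ℝ, E).tangent.tangent ∞
    (fun u ↦ (⟨u, X u⟩ : TangentBundle 𝓘(ℝ, E).tangent (TangentBundle 𝓘(ℝ, E) M))) (slit E M)

/-- The inclusion of the fibre `T_x M` into `TM`. As a vector space, `T_x M` is the model space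
`E`. -/
def fibreIncl (x : M) (w : E) : TangentBundle 𝓘(ℝ, E) M := ⟨x, w⟩

/-- A tangent vector `u`, as an element of the model space `E = T_{π u} M`. -/
def fibreCoord (u : TangentBundle 𝓘(ℝ, E) M) : E := u.2

/-- The fundamental `π`-vector field `u ↦ (u, u)`. -/
def eta (u : TangentBundle 𝓘(ℝ, E) M) : PiTM E M u := u.2

/-- The bundle map `ρ = (π_{TM}, dπ) : T(TM) → π⁻¹(TM)`. -/
def rho (u : TangentBundle 𝓘(ℝ, E) M) : TangentSpace 𝓘(ℝ, E).tangent u →L[ℝ] PiTM E M u :=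
  mfderiv 𝓘(ℝ, E).tangent 𝓘(ℝ, E) (projTM E M) u

/-- The bundle map `γ : π⁻¹(TM) → T(TM)`: the vertical lift, that is, the differential at `u` of the
inclusion of the fibre `T_{π u} M` (identified with its own tangent space) into `TM`. -/
def gamma (u : TangentBundle 𝓘(ℝ, E) M) : PiTM E M u →L[ℝ] TangentSpace 𝓘(ℝ, E).tangent u :=
  mfderiv 𝓘(ℝ, E) 𝓘(ℝ, E).tangent (fibreIncl u.proj) (fibreCoord u)

/-! ### Finsler structures -/

/-- The Hessian of the energy `½ L²` restricted to the fibre `T_{π u} M = E`, at the point `u`. -/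
def energyHessian (L : TangentBundle 𝓘(ℝ, E) M → ℝ) (u : TangentBundle 𝓘(ℝ, E) M) :
    E →L[ℝ] E →L[ℝ] ℝ :=
  fderiv ℝ (fderiv ℝ (fun w : E ↦ (1 / 2 : ℝ) * L (fibreIncl u.proj w) ^ 2)) (fibreCoord u)

/-- The metric on the pullback bundle defined by `L`, that is
`g_u(v, w) = ½ ∂²/∂s∂t L²(u + s v + t w)` at `s = t = 0`. -/
def metric (L : TangentBundle 𝓘(ℝ, E) M → ℝ) (u : TangentBundle 𝓘(ℝ, E) M) :
    PiTM E M u →L[ℝ] PiTM E M u →L[ℝ] ℝ :=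
  energyHessian (E := E) L u

/-- `L` is a Finsler structure on `M`: continuous on `TM`, smooth and positive on nonzero vectors,
positively homogeneous of degree one on each tangent space, with positive definite metric. -/
structure IsFinsler (L : TangentBundle 𝓘(ℝ, E) M → ℝ) : Prop where
  continuous : Continuous L
  smooth : ContMDiffOn 𝓘(ℝ, E).tangent 𝓘(ℝ, ℝ) ∞ L (slit E M)
  pos : ∀ u ∈ slit E M, 0 < L u
  homogeneous : ∀ (x : M) (y : TangentSpace 𝓘(ℝ, E) x) (t : ℝ), 0 < t →
    L ⟨x, t • y⟩ = t * L ⟨x, y⟩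
  posDef : ∀ u ∈ slit E M, ∀ v : PiTM E M u, v ≠ 0 → 0 < metric L u v v

/-! ### Connections on the pullback bundle -/

variable (E M) in
/-- The raw type of connections on the pullback bundle: `D Y u X` stands for `(D_X Y)(u)`, where `X`
is a tangent vector to `TM` at `u`. -/
abbrev PreConnection : Type _ :=
  (Π u : TangentBundle 𝓘(ℝ, E) M, PiTM E M u) →
    Π u : TangentBundle 𝓘(ℝ, E) M, TangentSpace 𝓘(ℝ, E).tangent u →L[ℝ] PiTM E M u

/-- `D` is a smooth linear connection on the pullback bundle over the slit tangent bundle. -/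
structure IsConnection (D : PreConnection E M) : Prop where
  isCovariantDerivativeOn : IsCovariantDerivativeOn E D (slit E M)
  smooth : ContMDiffCovariantDerivativeOn E ∞ D (slit E M)

/-- The vertical space at `u`. -/
def vertical (u : TangentBundle 𝓘(ℝ, E) M) : Submodule ℝ (TangentSpace 𝓘(ℝ, E).tangent u) :=
  LinearMap.ker (rho u).toLinearMap

/-- The horizontal space of `D` at `u`: the kernel of the connection map `K : X ↦ D_X η`. -/
def horizontal (D : PreConnection E M) (u : TangentBundle 𝓘(ℝ, E) M) :
    Submodule ℝ (TangentSpace 𝓘(ℝ, E).tangent u) :=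
  LinearMap.ker (D eta u).toLinearMap

/-- `D` is regular: tangent spaces are the direct sums of their vertical and horizontal spaces. -/
def IsRegular (D : PreConnection E M) : Prop :=
  ∀ u ∈ slit E M, IsCompl (vertical u) (horizontal D u)

/-- The horizontal map `β` of a regular connection `D`: the inverse of the restriction of `ρ` to the
horizontal space. -/
def beta (D : PreConnection E M) (u : TangentBundle 𝓘(ℝ, E) M) (v : PiTM E M u) :
    TangentSpace 𝓘(ℝ, E).tangent u :=
  Function.invFunOn (rho u) (horizontal D u : Set (TangentSpace 𝓘(ℝ, E).tangent u)) v

/-- The classical torsion `𝐓(X, Y) = D_X ρY - D_Y ρX - ρ[X, Y]`. -/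
def torsion (D : PreConnection E M)
    (X Y : Π u : TangentBundle 𝓘(ℝ, E) M, TangentSpace 𝓘(ℝ, E).tangent u)
    (u : TangentBundle 𝓘(ℝ, E) M) : PiTM E M u :=
  D (fun w ↦ rho w (Y w)) u (X u) - D (fun w ↦ rho w (X w)) u (Y u)
    - rho u (VectorField.mlieBracket 𝓘(ℝ, E).tangent X Y u)

/-- The (h)h-torsion `Q(X, Y) = 𝐓(βX, βY)`. -/
def hhTorsion (D : PreConnection E M) (X Y : Π u : TangentBundle 𝓘(ℝ, E) M, PiTM E M u) :
    Π u : TangentBundle 𝓘(ℝ, E) M, PiTM E M u :=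
  torsion D (fun w ↦ beta D w (X w)) (fun w ↦ beta D w (Y w))

/-- The (h)hv-torsion `T(X, Y) = 𝐓(γX, βY)`. -/
def hhvTorsion (D : PreConnection E M) (X Y : Π u : TangentBundle 𝓘(ℝ, E) M, PiTM E M u) :
    Π u : TangentBundle 𝓘(ℝ, E) M, PiTM E M u :=
  torsion D (fun w ↦ gamma w (X w)) (fun w ↦ beta D w (Y w))

/-- `D` is the Cartan connection of `(M, L)`: the regular connection which is metric, has vanishing
(h)h-torsion, and whose (h)hv-torsion satisfies `g(T(X, Y), Z) = g(T(X, Z), Y)`. -/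
structure IsCartanConnection (L : TangentBundle 𝓘(ℝ, E) M → ℝ) (D : PreConnection E M) :
    Prop where
  isConnection : IsConnection D
  isRegular : IsRegular D
  isMetric : ∀ Y Z : Π u : TangentBundle 𝓘(ℝ, E) M, PiTM E M u,
    IsSmoothPiField Y → IsSmoothPiField Z →
    ∀ u ∈ slit E M, ∀ X : TangentSpace 𝓘(ℝ, E).tangent u,
      mvfderiv 𝓘(ℝ, E).tangent (fun w ↦ metric L w (Y w) (Z w)) u X
        = metric L u (D Y u X) (Z u) + metric L u (Y u) (D Z u X)
  hhTorsion_eq_zero : ∀ X Y : Π u : TangentBundle 𝓘(ℝ, E) M, PiTM E M u,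
    IsSmoothPiField X → IsSmoothPiField Y → ∀ u ∈ slit E M, hhTorsion D X Y u = 0
  hhvTorsion_symm : ∀ X Y Z : Π u : TangentBundle 𝓘(ℝ, E) M, PiTM E M u,
    IsSmoothPiField X → IsSmoothPiField Y → IsSmoothPiField Z → ∀ u ∈ slit E M,
      metric L u (hhvTorsion D X Y u) (Z u) = metric L u (hhvTorsion D X Z u) (Y u)

/-- The `π`-vector field `ζ` is concurrent with respect to (the Cartan connection) `D`:
`D_X ζ = - ρX`. -/
structure IsConcurrent (D : PreConnection E M) (ζ : Π u : TangentBundle 𝓘(ℝ, E) M, PiTM E M u) :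
    Prop where
  smooth : IsSmoothPiField ζ
  cov_eq : ∀ u ∈ slit E M, ∀ X : TangentSpace 𝓘(ℝ, E).tangent u, D ζ u X = -rho u X

/-- `U(v, Y) = g(v, Y) / (1 + p²) ζ - g(v, η) / (1 + p²) D_{γζ} Y` at `u`, with `p² = g(ζ, ζ)`. -/
def horizontalChange (L : TangentBundle 𝓘(ℝ, E) M → ℝ) (D : PreConnection E M)
    (ζ : Π u : TangentBundle 𝓘(ℝ, E) M, PiTM E M u) (u : TangentBundle 𝓘(ℝ, E) M)
    (v : PiTM E M u) (Y : Π u : TangentBundle 𝓘(ℝ, E) M, PiTM E M u) : PiTM E M u :=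
  (metric L u v (Y u) / (1 + metric L u (ζ u) (ζ u))) • ζ u
    - (metric L u v (eta u) / (1 + metric L u (ζ u) (ζ u))) • D Y u (gamma u (ζ u))

end Finsler

end

open Bundle Manifold
open scoped Manifold ContDiff Topology

noncomputable section

namespace Finsler

variable {E : Type*} [NormedAddCommGroup E] [NormedSpace ℝ E]
  {M : Type*} [TopologicalSpace M] [ChartedSpace E M] [IsManifold 𝓘(ℝ, E) ∞ M]

/-! Write `ω = g(ζ, ·)`, `p² = g(ζ, ζ)`, `s = 1 + p²`. Metricity and concurrency give `d(p²)(X) = -2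
ω(ρX)`, so in a chart `(x, y)` of `TM` the function `p²` has no `y`-derivative and its
`x`-derivatives are the components of `-2ω`. By symmetry of second derivatives these components do
not depend on `y` (`mvfderiv_gamma_eq_zero_of_mvfderiv_eq`). Hence `B = ω(η)` has vanishing second
fibre derivatives and `g' = g + ω ⊗ ω` (`IsConcurrent.metric_eq`). Differentiating the components of
`ω` vertically also gives `ω(T) = 0`. As `g(T(·,·),·)` is half the third fibre derivative of the
energy, it is totally symmetric, so `T(ζ, ·) = 0` as well.

Vertical directions: on sections constant in a chart, `2 g(D_{γa} b, c)` is the fibre derivative of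
`g(b, c)`. The term `ω ⊗ ω` contributes nothing to it, and `ω(T) = 0` lets `g` be replaced by `g'`,
so the two vertical parts agree.

Horizontal directions: the expected formula says that `a(v, w) = D'_{βv} w - D_{βv} w + (g(v, w) /
s) ζ` vanishes. Since `g'(ζ, ·) = s ω`, metricity of both connections makes `a(v, ·)` skew for `g'`.
The horizontal map of `D'` is that of `D` corrected by a vertical lift involving `a(v, η)`, so the
vanishing (h)h-torsions express the antisymmetric part of `a` through `T` and `a(·, η)`.
`eq_zero_of_skew_of_torsion` then forces `a = 0`, by the argument for uniqueness of the Cartan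
connection.

Everything is computed on sections constant in a chart (`coordField`). Tensoriality of `D' - D`
extends the result to all sections. -/

/-! ### Coordinates on the tangent bundle -/

/-- The coordinates of an element of the pullback bundle over `w`, in the chart at `π u`. -/
def toModel (u w : TangentBundle 𝓘(ℝ, E) M) : PiTM E M w →L[ℝ] E :=
  (trivializationAt E (TangentSpace 𝓘(ℝ, E) : M → Type _) u.proj).continuousLinearMapAt ℝ w.proj

/-- The element of the pullback bundle over `w` with given coordinates in the chart at `π u`. -/
def ofModel (u w : TangentBundle 𝓘(ℝ, E) M) : E →L[ℝ] PiTM E M w :=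
  (trivializationAt E (TangentSpace 𝓘(ℝ, E) : M → Type _) u.proj).symmL ℝ w.proj

/-- The identification of the model space with the fibre of the pullback bundle over `w`. -/
def fibreId (w : TangentBundle 𝓘(ℝ, E) M) : E →L[ℝ] PiTM E M w :=
  ContinuousLinearMap.id ℝ E

variable (E M) in
/-- The set of tangent vectors whose base point lies in the source of the chart at `π u`. -/
def chartDom (u : TangentBundle 𝓘(ℝ, E) M) : Set (TangentBundle 𝓘(ℝ, E) M) :=
  {w | w.proj ∈ (chartAt E u.proj).source}

lemma toModel_ofModel {u w : TangentBundle 𝓘(ℝ, E) M} (hw : w ∈ chartDom E M u) (v : E) :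
    toModel u w (ofModel u w v) = v :=
  (trivializationAt E (TangentSpace 𝓘(ℝ, E) : M → Type _) u.proj).continuousLinearMapAt_symmL hw v

lemma ofModel_toModel {u w : TangentBundle 𝓘(ℝ, E) M} (hw : w ∈ chartDom E M u)
    (v : PiTM E M w) : ofModel u w (toModel u w v) = v :=
  (trivializationAt E (TangentSpace 𝓘(ℝ, E) : M → Type _) u.proj).symmL_continuousLinearMapAt hw v

omit [IsManifold 𝓘(ℝ, E) ∞ M] in
lemma mem_chartDom_self (u : TangentBundle 𝓘(ℝ, E) M) : u ∈ chartDom E M u :=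
  mem_chart_source E u.proj

lemma toModel_apply {u w : TangentBundle 𝓘(ℝ, E) M} (hw : w ∈ chartDom E M u) (v : PiTM E M w) :
    toModel u w v
      = (trivializationAt E (TangentSpace 𝓘(ℝ, E) : M → Type _) u.proj ⟨w.proj, v⟩).2 := by
  have := (trivializationAt E (TangentSpace 𝓘(ℝ, E) : M → Type _) u.proj).coe_linearMapAt_of_mem
    (R := ℝ) hw
  exact congrFun this v

lemma toModel_eq_mfderiv {u w : TangentBundle 𝓘(ℝ, E) M} (hw : w ∈ chartDom E M u) :
    toModel u w = mfderiv 𝓘(ℝ, E) 𝓘(ℝ, E) (extChartAt 𝓘(ℝ, E) u.proj) w.proj :=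
  TangentBundle.continuousLinearMapAt_trivializationAt hw

/-- The trivialization at `π u` is the identity on the fibre over `π u` itself, whatever the point
`y` of that fibre. -/
lemma toModel_fibreId (u : TangentBundle 𝓘(ℝ, E) M) (y v : E) :
    toModel u (fibreIncl u.proj y) (fibreId (fibreIncl u.proj y) v) = v :=
  (toModel_apply (u := u) (w := fibreIncl u.proj y) (mem_chartDom_self u) _).trans
    ((tangentBundleCore 𝓘(ℝ, E) M).coordChange_self _ _ (mem_chart_source E u.proj) v)

lemma ofModel_fibreId (u : TangentBundle 𝓘(ℝ, E) M) (y v : E) :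
    ofModel u (fibreIncl u.proj y) v = fibreId (fibreIncl u.proj y) v := by
  have := ofModel_toModel (u := u) (w := fibreIncl u.proj y) (mem_chartDom_self u)
    (fibreId (fibreIncl u.proj y) v)
  rwa [toModel_fibreId] at this

lemma isOpen_chartDom (u : TangentBundle 𝓘(ℝ, E) M) : IsOpen (chartDom E M u) :=
  (chartAt E u.proj).open_source.preimage
    (FiberBundle.continuous_proj E (TangentSpace 𝓘(ℝ, E) : M → Type _))

lemma chartDom_mem_nhds (u : TangentBundle 𝓘(ℝ, E) M) : chartDom E M u ∈ 𝓝 u :=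
  (isOpen_chartDom u).mem_nhds (mem_chartDom_self u)

lemma extChartAt_tangent_apply {u w : TangentBundle 𝓘(ℝ, E) M} (hw : w ∈ chartDom E M u) :
    extChartAt 𝓘(ℝ, E).tangent u w
      = (extChartAt 𝓘(ℝ, E) u.proj w.proj, toModel u w (eta w)) :=
  Prod.ext rfl (toModel_apply hw (eta w)).symm

lemma extChartAt_tangent_source (u : TangentBundle 𝓘(ℝ, E) M) :
    (extChartAt 𝓘(ℝ, E).tangent u).source = chartDom E M u := by
  ext w
  rw [extChartAt_source]
  exact TangentBundle.mem_chart_source_iff (I := 𝓘(ℝ, E)) w u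

lemma toModel_eta_self (u : TangentBundle 𝓘(ℝ, E) M) : toModel u u (eta u) = fibreCoord u :=
  toModel_fibreId u u.2 u.2

lemma isOpen_slit : IsOpen (slit E M) := by
  rw [isOpen_iff_mem_nhds]
  intro u hu
  have h1 : ContinuousAt (fun w ↦ (extChartAt 𝓘(ℝ, E).tangent u w).2) u :=
    (continuousAt_extChartAt (I := 𝓘(ℝ, E).tangent) u).snd
  have h2 : (extChartAt 𝓘(ℝ, E).tangent u u).2 ≠ 0 := by
    rw [extChartAt_tangent_apply (mem_chartDom_self u), toModel_eta_self]
    exact hu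
  filter_upwards [h1.eventually_ne h2, chartDom_mem_nhds u] with w hw hwd hw0
  apply hw
  rw [extChartAt_tangent_apply hwd, show eta w = 0 from hw0, map_zero]

lemma mdifferentiableAt_extChartAt_tangent {u w : TangentBundle 𝓘(ℝ, E) M} (hw : w ∈ chartDom E M u) :
    MDifferentiableAt 𝓘(ℝ, E).tangent 𝓘(ℝ, E × E) (extChartAt 𝓘(ℝ, E).tangent u) w := by
  have := mdifferentiableAt_extChartAt (I := 𝓘(ℝ, E).tangent) (x := u) (y := w)
    ((TangentBundle.mem_chart_source_iff (I := 𝓘(ℝ, E)) w u).2 hw)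
  exact this

/-- The derivative at `w` of the chart of `TM` at `u`. -/
def chartDeriv (u w : TangentBundle 𝓘(ℝ, E) M) : TangentSpace 𝓘(ℝ, E).tangent w →L[ℝ] E × E :=
  mfderiv 𝓘(ℝ, E).tangent 𝓘(ℝ, E × E) (extChartAt 𝓘(ℝ, E).tangent u) w

lemma chartDeriv_isInvertible {u w : TangentBundle 𝓘(ℝ, E) M} (hw : w ∈ chartDom E M u) :
    (chartDeriv u w).IsInvertible :=
  isInvertible_mfderiv_extChartAt (I := 𝓘(ℝ, E).tangent) (x := u)
    (by rw [extChartAt_tangent_source]; exact hw)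

/-- The first half of the chart of `TM` is the chart of `M` composed with the projection; both sides
are its derivative, computed in two ways. -/
lemma chartDeriv_fst {u w : TangentBundle 𝓘(ℝ, E) M} (hw : w ∈ chartDom E M u)
    (X : TangentSpace 𝓘(ℝ, E).tangent w) :
    (chartDeriv u w X).1 = toModel u w (rho w X) := by
  have h1 := (mdifferentiableAt_extChartAt_tangent hw).hasMFDerivAt
  have h2 : HasMFDerivAt 𝓘(ℝ, E × E) 𝓘(ℝ, E) (Prod.fst : E × E → E)
      (extChartAt 𝓘(ℝ, E).tangent u w) (ContinuousLinearMap.fst ℝ E E) :=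
    (ContinuousLinearMap.fst ℝ E E).hasMFDerivAt
  have h3 := h2.comp w h1
  have h4 : HasMFDerivAt 𝓘(ℝ, E).tangent 𝓘(ℝ, E) (projTM E M) w (rho w) :=
    ((projTM E M).contMDiff.mdifferentiableAt (by simp)).hasMFDerivAt
  have h5 : HasMFDerivAt 𝓘(ℝ, E) 𝓘(ℝ, E) (extChartAt 𝓘(ℝ, E) u.proj) w.proj (toModel u w) := by
    rw [toModel_eq_mfderiv hw]
    exact (mdifferentiableAt_extChartAt hw).hasMFDerivAt
  have h6 := HasMFDerivAt.comp w (f := projTM E M) h5 h4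
  exact DFunLike.congr_fun (hasMFDerivAt_unique h3 h6) X

lemma contMDiff_fibreIncl (x : M) :
    ContMDiff 𝓘(ℝ, E) 𝓘(ℝ, E).tangent ∞ (fibreIncl x : E → TangentBundle 𝓘(ℝ, E) M) := by
  intro y
  rw [contMDiffAt_totalSpace]
  refine ⟨contMDiffAt_const, ?_⟩
  refine contMDiffAt_id.congr_of_eventuallyEq (.of_forall fun w ↦ ?_)
  exact (tangentBundleCore 𝓘(ℝ, E) M).coordChange_self _ _ (mem_chart_source E x) w

lemma hasMFDerivAt_fibreIncl (u : TangentBundle 𝓘(ℝ, E) M) :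
    HasMFDerivAt 𝓘(ℝ, E) 𝓘(ℝ, E).tangent (fibreIncl u.proj) (fibreCoord u) (gamma u) :=
  ((contMDiff_fibreIncl u.proj).mdifferentiableAt (by simp)).hasMFDerivAt

lemma chartDeriv_gamma {u w : TangentBundle 𝓘(ℝ, E) M} (hw : w ∈ chartDom E M u)
    (v : PiTM E M w) : chartDeriv u w (gamma w v) = (0, toModel u w v) := by
  have h1 : HasMFDerivAt 𝓘(ℝ, E).tangent 𝓘(ℝ, E × E) (extChartAt 𝓘(ℝ, E).tangent u) w
    (chartDeriv u w) := (mdifferentiableAt_extChartAt_tangent hw).hasMFDerivAt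
  have h2 := HasMFDerivAt.comp (fibreCoord w) (f := fibreIncl w.proj) h1 (hasMFDerivAt_fibreIncl w)
  have h3 : HasFDerivAt (fun y : E ↦ (extChartAt 𝓘(ℝ, E) u.proj w.proj,
      (toModel u w ∘L fibreId w) y))
      (ContinuousLinearMap.prod 0 (toModel u w ∘L fibreId w)) (fibreCoord w) :=
    (hasFDerivAt_const _ _).prodMk (toModel u w ∘L fibreId w).hasFDerivAt
  have h4 : (extChartAt 𝓘(ℝ, E).tangent u ∘ fibreIncl w.proj) = (fun y : E ↦
      (extChartAt 𝓘(ℝ, E) u.proj w.proj, (toModel u w ∘L fibreId w) y)) := by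
    ext1 y
    exact extChartAt_tangent_apply (u := u) (w := fibreIncl w.proj y) hw
  rw [h4] at h2
  exact DFunLike.congr_fun (hasMFDerivAt_unique h2 h3.hasMFDerivAt) v

lemma rho_gamma (u : TangentBundle 𝓘(ℝ, E) M) (v : PiTM E M u) : rho u (gamma u v) = 0 := by
  have := chartDeriv_fst (mem_chartDom_self u) (gamma u v)
  rw [chartDeriv_gamma (mem_chartDom_self u)] at this
  rw [← ofModel_toModel (mem_chartDom_self u) (rho u (gamma u v)), ← this, map_zero]

lemma rho_surjective (u : TangentBundle 𝓘(ℝ, E) M) : Function.Surjective (rho u) := by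
  intro v
  obtain ⟨X, hX⟩ := (chartDeriv_isInvertible (mem_chartDom_self u)).bijective.2 (toModel u u v, 0)
  refine ⟨X, ?_⟩
  rw [← ofModel_toModel (mem_chartDom_self u) (rho u X), ← chartDeriv_fst (mem_chartDom_self u), hX,
    ofModel_toModel (mem_chartDom_self u)]

/-- Vertical vectors are vertical lifts. -/
lemma exists_gamma_eq {u : TangentBundle 𝓘(ℝ, E) M} {X : TangentSpace 𝓘(ℝ, E).tangent u}
    (hX : rho u X = 0) : ∃ v, gamma u v = X := by
  refine ⟨ofModel u u (chartDeriv u u X).2, ?_⟩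
  apply (chartDeriv_isInvertible (mem_chartDom_self u)).bijective.1
  rw [chartDeriv_gamma (mem_chartDom_self u), toModel_ofModel (mem_chartDom_self u)]
  refine Prod.ext ?_ rfl
  rw [chartDeriv_fst (mem_chartDom_self u), hX, map_zero]

/-! ### Smooth sections of the pullback bundle -/

/-- Smoothness of a section of the pullback bundle can be read in the coordinates of a chart. -/
lemma contMDiffAt_piField_iff {n : ℕ∞ω} {Y : Π u : TangentBundle 𝓘(ℝ, E) M, PiTM E M u}
    (hn : n ≤ ∞)
    {u w : TangentBundle 𝓘(ℝ, E) M} (hw : w ∈ chartDom E M u) :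
    ContMDiffAt 𝓘(ℝ, E).tangent (𝓘(ℝ, E).tangent.prod 𝓘(ℝ, E)) n
      (fun q ↦ (⟨q, Y q⟩ : TotalSpace E (PiTM E M))) w ↔
    ContMDiffAt 𝓘(ℝ, E).tangent 𝓘(ℝ, E) n (fun q ↦ toModel u q (Y q)) w := by
  have : ContMDiffVectorBundle n E (PiTM E M) 𝓘(ℝ, E).tangent := ContMDiffVectorBundle.of_le hn
  rw [(trivializationAt E (PiTM E M) u).contMDiffAt_section_iff (x₀ := w) hw]
  refine Filter.EventuallyEq.contMDiffAt_iff ?_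
  filter_upwards [(isOpen_chartDom u).mem_nhds hw] with q hq
  exact (toModel_apply hq (Y q)).symm

lemma IsSmoothPiField.contMDiffAt {Y : Π u : TangentBundle 𝓘(ℝ, E) M, PiTM E M u}
    (hY : IsSmoothPiField Y) {u w : TangentBundle 𝓘(ℝ, E) M} (hw : w ∈ chartDom E M u)
    (hws : w ∈ slit E M) :
    ContMDiffAt 𝓘(ℝ, E).tangent 𝓘(ℝ, E) ∞ (fun q ↦ toModel u q (Y q)) w :=
  (contMDiffAt_piField_iff le_rfl hw).1 ((hY w hws).contMDiffAt (isOpen_slit.mem_nhds hws))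

lemma IsSmoothPiField.mdifferentiableAt {Y : Π u : TangentBundle 𝓘(ℝ, E) M, PiTM E M u}
    (hY : IsSmoothPiField Y) {w : TangentBundle 𝓘(ℝ, E) M} (hws : w ∈ slit E M) :
    MDifferentiableAt 𝓘(ℝ, E).tangent (𝓘(ℝ, E).tangent.prod 𝓘(ℝ, E))
      (fun q ↦ (⟨q, Y q⟩ : TotalSpace E (PiTM E M))) w :=
  ((hY w hws).contMDiffAt (isOpen_slit.mem_nhds hws)).mdifferentiableAt (by simp)

lemma contMDiffAt_extChartAt_tangent {u w : TangentBundle 𝓘(ℝ, E) M} (hw : w ∈ chartDom E M u) :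
    ContMDiffAt 𝓘(ℝ, E).tangent 𝓘(ℝ, E × E) ∞ (extChartAt 𝓘(ℝ, E).tangent u) w :=
  contMDiffAt_extChartAt' (I := 𝓘(ℝ, E).tangent) (x := u)
    ((TangentBundle.mem_chart_source_iff (I := 𝓘(ℝ, E)) w u).2 hw)

lemma contMDiffAt_toModel_eta {u w : TangentBundle 𝓘(ℝ, E) M} (hw : w ∈ chartDom E M u) :
    ContMDiffAt 𝓘(ℝ, E).tangent 𝓘(ℝ, E) ∞ (fun q ↦ toModel u q (eta q)) w := by
  have h1 := contMDiffAt_extChartAt_tangent hw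
  have h2 : ContMDiffAt 𝓘(ℝ, E × E) 𝓘(ℝ, E) ∞ (Prod.snd : E × E → E)
      (extChartAt 𝓘(ℝ, E).tangent u w) := contDiff_snd.contMDiff.contMDiffAt
  refine (h2.comp w h1).congr_of_eventuallyEq ?_
  filter_upwards [(isOpen_chartDom u).mem_nhds hw] with q hq
  exact (congrArg Prod.snd (extChartAt_tangent_apply hq)).symm

lemma isSmoothPiField_eta : IsSmoothPiField (eta (E := E) (M := M)) := fun u _ ↦
  ((contMDiffAt_piField_iff le_rfl (mem_chartDom_self u)).2
    (contMDiffAt_toModel_eta (mem_chartDom_self u))).contMDiffWithinAt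

/-! ### Global extension of chart-constant sections by bump functions -/

section frame

variable [FiniteDimensional ℝ E] [T2Space M]

/-- A global section of the pullback bundle whose coordinates in the chart at `π u` are equal to `v`
near the fibre of `u`. -/
def frame (u : TangentBundle 𝓘(ℝ, E) M) (v : E) (w : TangentBundle 𝓘(ℝ, E) M) : PiTM E M w :=
  (Classical.arbitrary (SmoothBumpFunction 𝓘(ℝ, E) u.proj) : M → ℝ) w.proj • ofModel u w v

lemma isSmoothPiField_frame (u : TangentBundle 𝓘(ℝ, E) M) (v : E) :
    IsSmoothPiField (frame u v) := by
  set χ := Classical.arbitrary (SmoothBumpFunction 𝓘(ℝ, E) u.proj) with hχ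
  have hπ : ContMDiff 𝓘(ℝ, E).tangent 𝓘(ℝ, E) ∞ (projTM E M) := (projTM E M).contMDiff
  have hc : ContMDiff 𝓘(ℝ, E).tangent 𝓘(ℝ, ℝ) ∞ (fun q ↦ χ (projTM E M q)) :=
    χ.contMDiff.comp hπ
  intro w _
  apply ContMDiffAt.contMDiffWithinAt
  by_cases hw : w ∈ chartDom E M u
  · rw [contMDiffAt_piField_iff le_rfl hw]
    refine ((hc.smul (contMDiff_const (c := v))).contMDiffAt).congr_of_eventuallyEq ?_
    filter_upwards [(isOpen_chartDom u).mem_nhds hw] with q hq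
    rw [frame, map_smul, toModel_ofModel hq]
    rfl
  -- Outside the chart domain the section vanishes near `w`, because the support of the bump
  -- function is closed and contained in the chart.
  · rw [contMDiffAt_piField_iff (u := w) le_rfl (mem_chartDom_self w)]
    refine (contMDiffAt_const (c := (0 : E))).congr_of_eventuallyEq ?_
    have h1 : w.proj ∈ (tsupport χ)ᶜ := fun h ↦ hw (χ.tsupport_subset_chartAt_source h)
    have h2 : {q : TangentBundle 𝓘(ℝ, E) M | q.proj ∈ (tsupport χ)ᶜ} ∈ 𝓝 w :=
      ((isClosed_tsupport χ).isOpen_compl.preimage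
        (FiberBundle.continuous_proj E (TangentSpace 𝓘(ℝ, E) : M → Type _))).mem_nhds h1
    filter_upwards [h2] with q hq
    rw [frame, ← hχ, image_eq_zero_of_notMem_tsupport hq, zero_smul, map_zero]

omit [T2Space M] in
lemma frame_eventuallyEq (u : TangentBundle 𝓘(ℝ, E) M) (v : E) (y : E) :
    ∀ᶠ w in 𝓝 (fibreIncl u.proj y), frame u v w = ofModel u w v := by
  have h1 := (Classical.arbitrary (SmoothBumpFunction 𝓘(ℝ, E) u.proj)).eventuallyEq_one
  have h2 : Filter.Tendsto (fun w : TangentBundle 𝓘(ℝ, E) M ↦ w.proj) (𝓝 (fibreIncl u.proj y))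
    (𝓝 u.proj) :=
    (FiberBundle.continuous_proj E (TangentSpace 𝓘(ℝ, E) : M → Type _)).tendsto (fibreIncl u.proj y)
  filter_upwards [h2.eventually h1] with w hw
  rw [frame, hw, Pi.one_apply, one_smul]

-- The bump function depends on the base point only, so the section is constant along the whole
-- fibre over `π u`. Vertical derivatives at `u` thereby become derivatives on the vector space `E`.
omit [T2Space M] in
lemma frame_fibre (u : TangentBundle 𝓘(ℝ, E) M) (v : E) (y : E) :
    frame u v (fibreIncl u.proj y) = fibreId (fibreIncl u.proj y) v :=
  (frame_eventuallyEq u v y).self_of_nhds.trans (ofModel_fibreId u y v)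

omit [T2Space M] in
lemma frame_self (u : TangentBundle 𝓘(ℝ, E) M) (v : E) : frame u v u = fibreId u v :=
  frame_fibre u v u.2

omit [T2Space M] in
lemma frame_eventuallyEq_self (u : TangentBundle 𝓘(ℝ, E) M) (v : E) :
    ∀ᶠ w in 𝓝 u, frame u v w = ofModel u w v :=
  frame_eventuallyEq u v u.2

end frame

/-! ### The bracket of lifts of coordinate fields -/

lemma fst_lieBracketWithin_eq_zero {V W : E × E → E × E} {s : Set (E × E)} {p : E × E} {v w : E}
    (hs : s = Set.univ)
    (hV : ∀ᶠ q in 𝓝 p, (V q).1 = v) (hW : ∀ᶠ q in 𝓝 p, (W q).1 = w) :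
    (VectorField.lieBracketWithin ℝ V W s p).1 = 0 := by
  subst hs
  have key : ∀ {V : E × E → E × E} {v : E}, (∀ᶠ q in 𝓝 p, (V q).1 = v) → ∀ a,
      (fderiv ℝ V p a).1 = 0 := by
    intro V v hV a
    by_cases hd : DifferentiableAt ℝ V p
    · have h1 := (ContinuousLinearMap.fst ℝ E E).hasFDerivAt.comp p hd.hasFDerivAt
      have h2 : HasFDerivAt (ContinuousLinearMap.fst ℝ E E ∘ V) (0 : E × E →L[ℝ] E) p :=
        (hasFDerivAt_const v p).congr_of_eventuallyEq hV
      exact DFunLike.congr_fun (h1.unique h2) a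
    -- Without differentiability `fderiv` is zero by convention. This case spares any proof that the
    -- horizontal lifts, defined through `Function.invFunOn`, are smooth.
    · rw [fderiv_zero_of_not_differentiableAt hd]; rfl
  rw [VectorField.lieBracketWithin_univ, VectorField.lieBracket, Prod.fst_sub, key hW, key hV, sub_zero]

/-- In the chart the `M`-components of both fields are locally constant, so the bracket has no
`M`-component. Vertical fields are covered by the value `0` of the constant. -/
lemma rho_mlieBracket_eq_zero
    [FiniteDimensional ℝ E]
    {V W : Π u : TangentBundle 𝓘(ℝ, E) M, TangentSpace 𝓘(ℝ, E).tangent u}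
    {u : TangentBundle 𝓘(ℝ, E) M} {v w : E}
    (hV : ∀ᶠ q in 𝓝 u, rho q (V q) = ofModel u q v)
    (hW : ∀ᶠ q in 𝓝 u, rho q (W q) = ofModel u q w) :
    rho u (VectorField.mlieBracket 𝓘(ℝ, E).tangent V W u) = 0 := by
  have hr : Set.range (𝓘(ℝ, E).tangent : E × E → E × E) = Set.univ :=
    ModelWithCorners.range_eq_univ 𝓘(ℝ, E).tangent
  have key : ∀ {V : Π u : TangentBundle 𝓘(ℝ, E) M, TangentSpace 𝓘(ℝ, E).tangent u} {v : E},
      (∀ᶠ q in 𝓝 u, rho q (V q) = ofModel u q v) →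
      ∀ᶠ p : E × E in 𝓝 (extChartAt 𝓘(ℝ, E).tangent u u),
        (VectorField.mpullbackWithin 𝓘(ℝ, E × E) 𝓘(ℝ, E).tangent
          (extChartAt 𝓘(ℝ, E).tangent u).symm V (Set.range 𝓘(ℝ, E).tangent) p : E × E).1 = v := by
    intro V v hV
    have hc := continuousAt_extChartAt_symm (I := 𝓘(ℝ, E).tangent) u
    have hT : ∀ᶠ p : E × E in 𝓝 (extChartAt 𝓘(ℝ, E).tangent u u),
        p ∈ (extChartAt 𝓘(ℝ, E).tangent u).target := extChartAt_target_mem_nhds u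
    have hV' : ∀ᶠ q in 𝓝 ((extChartAt 𝓘(ℝ, E).tangent u).symm (extChartAt 𝓘(ℝ, E).tangent u u)),
        rho q (V q) = ofModel u q v := by rwa [extChartAt_to_inv]
    filter_upwards [hT, hc.eventually hV'] with p hp hq
    set q := (extChartAt 𝓘(ℝ, E).tangent u).symm p with hqdef
    have hqd : q ∈ chartDom E M u := by
      rw [← extChartAt_tangent_source]; exact (extChartAt 𝓘(ℝ, E).tangent u).map_target hp
    have h1 := mfderiv_extChartAt_comp_mfderivWithin_extChartAt_symm (I := 𝓘(ℝ, E).tangent) hp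
    have h2 := mfderivWithin_extChartAt_symm_comp_mfderiv_extChartAt (I := 𝓘(ℝ, E).tangent) hp
    -- Pulling back along the inverse chart is pushing forward by the derivative of the chart, whose
    -- first component is known from `chartDeriv_fst`.
    have h3 : (mfderivWithin 𝓘(ℝ, E × E) 𝓘(ℝ, E).tangent (extChartAt 𝓘(ℝ, E).tangent u).symm
        (Set.range 𝓘(ℝ, E).tangent) p).inverse = chartDeriv u q :=
      ContinuousLinearMap.inverse_eq h2 h1
    rw [VectorField.mpullbackWithin_apply, h3]
    refine (chartDeriv_fst hqd (V q)).trans ?_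
    rw [hq, toModel_ofModel hqd]
  have hs : (extChartAt 𝓘(ℝ, E).tangent u).symm ⁻¹' Set.univ ∩ Set.range 𝓘(ℝ, E).tangent
      = (Set.univ : Set (E × E)) := by rw [hr, Set.preimage_univ, Set.univ_inter]
  have hb := fst_lieBracketWithin_eq_zero hs (key hV) (key hW)
  have h1 := (chartDeriv_isInvertible (mem_chartDom_self u)).self_apply_inverse
    (VectorField.lieBracketWithin ℝ (VectorField.mpullbackWithin 𝓘(ℝ, E × E) 𝓘(ℝ, E).tangent
          (extChartAt 𝓘(ℝ, E).tangent u).symm V (Set.range 𝓘(ℝ, E).tangent))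
        (VectorField.mpullbackWithin 𝓘(ℝ, E × E) 𝓘(ℝ, E).tangent
          (extChartAt 𝓘(ℝ, E).tangent u).symm W (Set.range 𝓘(ℝ, E).tangent))
        ((extChartAt 𝓘(ℝ, E).tangent u).symm ⁻¹' Set.univ ∩ Set.range 𝓘(ℝ, E).tangent)
        (extChartAt 𝓘(ℝ, E).tangent u u))
  have h2 := chartDeriv_fst (mem_chartDom_self u)
    (VectorField.mlieBracket 𝓘(ℝ, E).tangent V W u)
  rw [← ofModel_toModel (mem_chartDom_self u)
    (rho u (VectorField.mlieBracket 𝓘(ℝ, E).tangent V W u)),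
    h2.symm.trans ((congrArg Prod.fst h1).trans hb), map_zero]

/-! ### Derivatives along the fibres -/

lemma two_le_infty : (2 : ℕ∞ω) ≤ ∞ := WithTop.coe_le_coe.2 (le_top (a := (2 : ℕ∞)))

lemma minSmoothness_le_infty : minSmoothness ℝ 2 ≤ ∞ := by simpa using two_le_infty

/-- The second derivative of a composition with an affine map. -/
lemma fderiv_fderiv_comp_affine {V W : Type*} [NormedAddCommGroup V] [NormedSpace ℝ V]
    [NormedAddCommGroup W] [NormedSpace ℝ W] {F : W → ℝ} {A : V → W} {ℓ : V →L[ℝ] W} {y : V}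
    (hA : ∀ z, HasFDerivAt A ℓ z) (hF : ContDiffAt ℝ 2 F (A y)) (a b : V) :
    fderiv ℝ (fderiv ℝ (F ∘ A)) y a b = fderiv ℝ (fderiv ℝ F) (A y) (ℓ a) (ℓ b) := by
  have h1 : ∀ᶠ z in 𝓝 y, DifferentiableAt ℝ F (A z) :=
    (hA y).continuousAt.eventually
      ((hF.eventually (by simp)).mono fun p hp ↦ hp.differentiableAt (by simp))
  have h2 : fderiv ℝ (F ∘ A) =ᶠ[𝓝 y]
      (ContinuousLinearMap.compL ℝ V W ℝ).flip ℓ ∘ (fderiv ℝ F ∘ A) := by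
    filter_upwards [h1] with z hz
    exact (hz.hasFDerivAt.comp z (hA z)).fderiv
  have h3 : DifferentiableAt ℝ (fderiv ℝ F) (A y) :=
    (hF.fderiv_right (m := 1) (by norm_num)).differentiableAt (by simp)
  have h4 := ((ContinuousLinearMap.compL ℝ V W ℝ).flip ℓ).hasFDerivAt.comp y
    (h3.hasFDerivAt.comp y (hA y))
  rw [h2.fderiv_eq, h4.fderiv]
  rfl

/-- The energy `½ L²` on the fibre over `x`. -/
def fibreEnergy (L : TangentBundle 𝓘(ℝ, E) M → ℝ) (x : M) (w : E) : ℝ :=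
  1 / 2 * L (fibreIncl x w) ^ 2

lemma IsFinsler.contDiffAt_fibreEnergy {L : TangentBundle 𝓘(ℝ, E) M → ℝ} (hL : IsFinsler L)
    (x : M) {y : E} (hy : y ≠ 0) : ContDiffAt ℝ ∞ (fibreEnergy L x) y := by
  have h1 : fibreIncl x y ∈ slit E M := hy
  have h2 : ContMDiffAt 𝓘(ℝ, E) 𝓘(ℝ, ℝ) ∞ (L ∘ fibreIncl x) y :=
    ((hL.smooth _ h1).contMDiffAt (isOpen_slit.mem_nhds h1)).comp y (contMDiff_fibreIncl x y)
  exact contDiffAt_const.mul (h2.contDiffAt.pow 2)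

lemma IsFinsler.fibreEnergy_smul {L : TangentBundle 𝓘(ℝ, E) M → ℝ} (hL : IsFinsler L)
    (x : M) (y : E) {t : ℝ} (ht : 0 < t) : fibreEnergy L x (t • y) = t ^ 2 * fibreEnergy L x y := by
  have := hL.homogeneous x y t ht
  change 1 / 2 * L ⟨x, t • y⟩ ^ 2 = t ^ 2 * (1 / 2 * L ⟨x, y⟩ ^ 2)
  erw [this]
  ring

/-- Each differentiation lowers the degree of homogeneity by one. Applied to the energy, it makes
the metric constant along rays. -/
lemma fderiv_fderiv_smul_of_homogeneous {V : Type*} [NormedAddCommGroup V] [NormedSpace ℝ V]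
    {f : V → ℝ} (hf : ∀ t : ℝ, 0 < t → ∀ y, f (t • y) = t ^ 2 * f y) {t : ℝ} (ht : 0 < t) (y : V) :
    fderiv ℝ (fderiv ℝ f) (t • y) = fderiv ℝ (fderiv ℝ f) y := by
  have h1 : ∀ y, fderiv ℝ f (t • y) = t • fderiv ℝ f y := by
    intro y
    have h := fderiv_comp_smul (f := f) (x := y) t
    have h' : (fun z ↦ f (t • z)) = fun z ↦ t ^ 2 • f z := by
      ext z; exact hf t ht z
    have h'' : fderiv ℝ (fun z ↦ t ^ 2 • f z) y = t ^ 2 • fderiv ℝ f y :=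
      congrFun (fderiv_const_smul_field (t ^ 2)) y
    rw [h', h''] at h
    have := congrArg (fun A ↦ t⁻¹ • A) h
    simp only [smul_smul, inv_mul_cancel₀ ht.ne', one_smul] at this
    rw [← this, sq, ← mul_assoc, inv_mul_cancel₀ ht.ne', one_mul]
  have h := fderiv_comp_smul (f := fderiv ℝ f) (x := y) t
  have h' : (fun z ↦ fderiv ℝ f (t • z)) = t • fderiv ℝ f := funext h1
  have h'' : fderiv ℝ (t • fderiv ℝ f) y = t • fderiv ℝ (fderiv ℝ f) y :=
    congrFun (fderiv_const_smul_field (𝕜 := ℝ) (f := fderiv ℝ f) t) y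
  rw [h', h''] at h
  exact (smul_right_injective _ ht.ne' h).symm

lemma hasFDerivAt_fderiv_fderiv_apply {V : Type*} [NormedAddCommGroup V] [NormedSpace ℝ V]
    {f : V → ℝ} {y : V} (hf : ContDiffAt ℝ ∞ f y) (b c : V) :
    HasFDerivAt (fun y ↦ fderiv ℝ (fderiv ℝ f) y b c)
      (((ContinuousLinearMap.apply ℝ ℝ c).comp
        ((ContinuousLinearMap.apply ℝ (V →L[ℝ] ℝ) b).comp
          (fderiv ℝ (fderiv ℝ (fderiv ℝ f)) y)))) y := by
  have h1 : ContDiffAt ℝ ∞ (fderiv ℝ (fderiv ℝ f)) y :=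
    (hf.fderiv_right (m := ∞) (by simp)).fderiv_right (m := ∞) (by simp)
  have h2 := (h1.differentiableAt (by simp)).hasFDerivAt
  refine ((h2.clm_apply (hasFDerivAt_const b y)).clm_apply (hasFDerivAt_const c y)).congr_fderiv ?_
  ext a
  simp

/-- The Cartan tensor at `u`, up to the factor `2`: the third derivative of the energy. -/
def cartanTensor (L : TangentBundle 𝓘(ℝ, E) M → ℝ) (u : TangentBundle 𝓘(ℝ, E) M) (a b c : E) : ℝ :=
  fderiv ℝ (fderiv ℝ (fderiv ℝ (fibreEnergy L u.proj))) (fibreCoord u) a b c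

/-! ### Symmetries of the metric and of the Cartan tensor -/

section

variable {L : TangentBundle 𝓘(ℝ, E) M → ℝ} (hL : IsFinsler L)
include hL

lemma IsFinsler.metric_symm {u : TangentBundle 𝓘(ℝ, E) M} (hu : u ∈ slit E M) (v w : PiTM E M u) :
    metric L u v w = metric L u w v :=
  ((hL.contDiffAt_fibreEnergy u.proj (y := fibreCoord u) hu).isSymmSndFDerivAt
    minSmoothness_le_infty).eq v w

lemma IsFinsler.cartanTensor_swap_left {u : TangentBundle 𝓘(ℝ, E) M} (hu : u ∈ slit E M)
    (a b c : E) : cartanTensor L u a b c = cartanTensor L u b a c := by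
  have h := (hL.contDiffAt_fibreEnergy u.proj (y := fibreCoord u) hu).fderiv_right (m := ∞)
    (by simp)
  exact DFunLike.congr_fun ((h.isSymmSndFDerivAt minSmoothness_le_infty).eq a b) c

lemma IsFinsler.hasFDerivAt_metric {u : TangentBundle 𝓘(ℝ, E) M} (hu : u ∈ slit E M) (b c : E) :
    HasFDerivAt (fun y ↦ fderiv ℝ (fderiv ℝ (fibreEnergy L u.proj)) y b c)
      (((ContinuousLinearMap.apply ℝ ℝ c).comp
        ((ContinuousLinearMap.apply ℝ (E →L[ℝ] ℝ) b).comp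
          (fderiv ℝ (fderiv ℝ (fderiv ℝ (fibreEnergy L u.proj))) (fibreCoord u)))))
      (fibreCoord u) :=
  hasFDerivAt_fderiv_fderiv_apply (hL.contDiffAt_fibreEnergy u.proj (y := fibreCoord u) hu) b c

/-- The Hessian is symmetric at every nonzero vector, hence near `u`, and this identity can be
differentiated. -/
lemma IsFinsler.cartanTensor_swap_right {u : TangentBundle 𝓘(ℝ, E) M} (hu : u ∈ slit E M)
    (a b c : E) : cartanTensor L u a b c = cartanTensor L u a c b := by
  have h1 := hL.hasFDerivAt_metric hu b c
  have h2 := hL.hasFDerivAt_metric hu c b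
  have h3 : (fun y ↦ fderiv ℝ (fderiv ℝ (fibreEnergy L u.proj)) y b c) =ᶠ[𝓝 (fibreCoord u)]
      fun y ↦ fderiv ℝ (fderiv ℝ (fibreEnergy L u.proj)) y c b := by
    filter_upwards [isOpen_ne.mem_nhds (show fibreCoord u ≠ 0 from hu)] with y hy
    exact ((hL.contDiffAt_fibreEnergy u.proj hy).isSymmSndFDerivAt minSmoothness_le_infty).eq b c
  exact DFunLike.congr_fun (h1.unique (h2.congr_of_eventuallyEq h3)) a

lemma IsFinsler.cartanTensor_eta {u : TangentBundle 𝓘(ℝ, E) M} (hu : u ∈ slit E M)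
    (b c : E) : cartanTensor L u (fibreCoord u) b c = 0 := by
  have h1 := hL.hasFDerivAt_metric hu b c
  -- The base point is viewed as the value at `t = 1` of the ray `t ↦ t • u`, along which the metric
  -- is constant.
  rw [show fibreCoord u = (1 : ℝ) • fibreCoord u from (one_smul _ _).symm] at h1
  have h2 := h1.comp_hasDerivAt (1 : ℝ) ((hasDerivAt_id (1 : ℝ)).smul_const (fibreCoord u))
  have h3 : HasDerivAt ((fun y ↦ fderiv ℝ (fderiv ℝ (fibreEnergy L u.proj)) y b c) ∘
      fun t : ℝ ↦ t • fibreCoord u) 0 1 := by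
    refine (hasDerivAt_const (1 : ℝ)
      (fderiv ℝ (fderiv ℝ (fibreEnergy L u.proj)) (fibreCoord u) b c)).congr_of_eventuallyEq ?_
    filter_upwards [lt_mem_nhds (zero_lt_one' ℝ)] with t ht
    simp only [Function.comp_apply]
    rw [fderiv_fderiv_smul_of_homogeneous (fun t ht y ↦ hL.fibreEnergy_smul u.proj y ht) ht]
  have h4 := h2.unique h3
  simpa [cartanTensor] using h4

end

/-- The derivative of a function on `TM` along a vertical lift is the derivative of its restriction
to the fibre. -/
lemma hasFDerivAt_comp_fibreIncl {F : TangentBundle 𝓘(ℝ, E) M → ℝ} {u : TangentBundle 𝓘(ℝ, E) M}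
    (hF : MDifferentiableAt 𝓘(ℝ, E).tangent 𝓘(ℝ, ℝ) F u) :
    HasFDerivAt (F ∘ fibreIncl u.proj)
      ((mvfderiv 𝓘(ℝ, E).tangent F u).comp ((gamma u).comp (fibreId u))) (fibreCoord u) :=
  (HasMFDerivAt.comp (fibreCoord u) (f := fibreIncl u.proj) (g := F) (I' := 𝓘(ℝ, E).tangent)
    hF.hasMFDerivAt (hasMFDerivAt_fibreIncl u)).hasFDerivAt

/-! ### Smoothness of the metric -/

/-- The energy `½ L²` in the chart at `u`. -/
def localEnergy (L : TangentBundle 𝓘(ℝ, E) M → ℝ) (u : TangentBundle 𝓘(ℝ, E) M) (p : E × E) : ℝ :=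
  1 / 2 * L ((extChartAt 𝓘(ℝ, E).tangent u).symm p) ^ 2

/-- A function which is smooth at `w` is smooth in the chart at `u`. -/
lemma contDiffAt_comp_extChartAt_symm {F : TangentBundle 𝓘(ℝ, E) M → ℝ}
    {u w : TangentBundle 𝓘(ℝ, E) M} (hw : w ∈ chartDom E M u)
    (hF : ContMDiffAt 𝓘(ℝ, E).tangent 𝓘(ℝ, ℝ) ∞ F w) :
    ContDiffAt ℝ ∞ (F ∘ (extChartAt 𝓘(ℝ, E).tangent u).symm)
      (extChartAt 𝓘(ℝ, E).tangent u w) := by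
  have hw' : w ∈ (extChartAt 𝓘(ℝ, E).tangent u).source := by rwa [extChartAt_tangent_source]
  have h1 : ContMDiffAt 𝓘(ℝ, E × E) 𝓘(ℝ, E).tangent ∞ (extChartAt 𝓘(ℝ, E).tangent u).symm
      (extChartAt 𝓘(ℝ, E).tangent u w) :=
    (contMDiffOn_extChartAt_symm (I := 𝓘(ℝ, E).tangent) u).contMDiffAt
      (extChartAt_target_mem_nhds' (I := 𝓘(ℝ, E).tangent)
        ((extChartAt 𝓘(ℝ, E).tangent u).map_source hw'))
  have h2 : ContMDiffAt 𝓘(ℝ, E).tangent 𝓘(ℝ, ℝ) ∞ F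
      ((extChartAt 𝓘(ℝ, E).tangent u).symm (extChartAt 𝓘(ℝ, E).tangent u w)) := by
    rwa [(extChartAt 𝓘(ℝ, E).tangent u).left_inv hw']
  exact (h2.comp _ h1).contDiffAt

section

variable {L : TangentBundle 𝓘(ℝ, E) M → ℝ} (hL : IsFinsler L)
include hL

lemma IsFinsler.contDiffAt_localEnergy {u w : TangentBundle 𝓘(ℝ, E) M} (hw : w ∈ chartDom E M u)
    (hws : w ∈ slit E M) :
    ContDiffAt ℝ ∞ (localEnergy L u) (extChartAt 𝓘(ℝ, E).tangent u w) :=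
  contDiffAt_const.mul ((contDiffAt_comp_extChartAt_symm hw
    ((hL.smooth w hws).contMDiffAt (isOpen_slit.mem_nhds hws))).pow 2)

/-- Seen in the chart, the inclusion of a fibre is affine with linear part `y ↦ (0, toModel u w y)`.
Expressing all nearby metrics by one Hessian on `E × E` is what yields their smoothness. -/
lemma IsFinsler.metric_eq_localEnergy {u w : TangentBundle 𝓘(ℝ, E) M} (hw : w ∈ chartDom E M u)
    (hws : w ∈ slit E M) (a b : PiTM E M w) :
    metric L w a b = fderiv ℝ (fderiv ℝ (localEnergy L u)) (extChartAt 𝓘(ℝ, E).tangent u w)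
      (0, toModel u w a) (0, toModel u w b) := by
  have hA : ∀ y, HasFDerivAt (fun y : E ↦ (extChartAt 𝓘(ℝ, E) u.proj w.proj,
      (toModel u w ∘L fibreId w) y))
      (ContinuousLinearMap.prod 0 (toModel u w ∘L fibreId w)) y := fun y ↦
    (hasFDerivAt_const _ _).prodMk (toModel u w ∘L fibreId w).hasFDerivAt
  have h4 : (extChartAt 𝓘(ℝ, E).tangent u ∘ fibreIncl w.proj) = (fun y : E ↦
      (extChartAt 𝓘(ℝ, E) u.proj w.proj, (toModel u w ∘L fibreId w) y)) := by
    ext1 y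
    exact extChartAt_tangent_apply (u := u) (w := fibreIncl w.proj y) hw
  rw [← h4] at hA
  have h5 : fibreEnergy L w.proj
      = localEnergy L u ∘ (extChartAt 𝓘(ℝ, E).tangent u ∘ fibreIncl w.proj) := by
    ext1 y
    have : fibreIncl w.proj y ∈ (extChartAt 𝓘(ℝ, E).tangent u).source := by
      rw [extChartAt_tangent_source]; exact hw
    simp only [Function.comp_apply, localEnergy, (extChartAt 𝓘(ℝ, E).tangent u).left_inv this]
    rfl
  have h6 := fderiv_fderiv_comp_affine hA (y := fibreCoord w) (F := localEnergy L u)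
    ((hL.contDiffAt_localEnergy hw hws).of_le two_le_infty) a b
  rw [← h5] at h6
  exact h6

lemma IsFinsler.contMDiffAt_metric {u w : TangentBundle 𝓘(ℝ, E) M} (hw : w ∈ chartDom E M u)
    (hws : w ∈ slit E M) {Y Z : Π u : TangentBundle 𝓘(ℝ, E) M, PiTM E M u}
    (hY : ContMDiffAt 𝓘(ℝ, E).tangent 𝓘(ℝ, E) ∞ (fun q ↦ toModel u q (Y q)) w)
    (hZ : ContMDiffAt 𝓘(ℝ, E).tangent 𝓘(ℝ, E) ∞ (fun q ↦ toModel u q (Z q)) w) :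
    ContMDiffAt 𝓘(ℝ, E).tangent 𝓘(ℝ, ℝ) ∞ (fun q ↦ metric L q (Y q) (Z q)) w := by
  have h1 : ContDiffAt ℝ ∞ (fderiv ℝ (fderiv ℝ (localEnergy L u)))
      (extChartAt 𝓘(ℝ, E).tangent u w) :=
    ((hL.contDiffAt_localEnergy hw hws).fderiv_right (m := ∞) (by simp)).fderiv_right
      (m := ∞) (by simp)
  have h2 : ContMDiffAt 𝓘(ℝ, E).tangent _ ∞ (fun q ↦ fderiv ℝ (fderiv ℝ (localEnergy L u))
      (extChartAt 𝓘(ℝ, E).tangent u q)) w :=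
    h1.contMDiffAt.comp w (contMDiffAt_extChartAt_tangent hw)
  have h3 : ∀ {Y : Π u : TangentBundle 𝓘(ℝ, E) M, PiTM E M u},
      ContMDiffAt 𝓘(ℝ, E).tangent 𝓘(ℝ, E) ∞ (fun q ↦ toModel u q (Y q)) w →
      ContMDiffAt 𝓘(ℝ, E).tangent 𝓘(ℝ, E × E) ∞ (fun q ↦ ((0 : E), toModel u q (Y q))) w :=
    fun h ↦ (contMDiffAt_const (c := (0 : E))).prodMk_space h
  refine ((h2.clm_apply (h3 hY)).clm_apply (h3 hZ)).congr_of_eventuallyEq ?_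
  filter_upwards [(isOpen_chartDom u).mem_nhds hw, isOpen_slit.mem_nhds hws] with q hq hqs
  exact hL.metric_eq_localEnergy hq hqs _ _

lemma IsFinsler.contMDiffAt_metric_of_isSmoothPiField {w : TangentBundle 𝓘(ℝ, E) M}
    (hws : w ∈ slit E M) {Y Z : Π u : TangentBundle 𝓘(ℝ, E) M, PiTM E M u}
    (hY : IsSmoothPiField Y) (hZ : IsSmoothPiField Z) :
    ContMDiffAt 𝓘(ℝ, E).tangent 𝓘(ℝ, ℝ) ∞ (fun q ↦ metric L q (Y q) (Z q)) w :=
  hL.contMDiffAt_metric (mem_chartDom_self w) hws (hY.contMDiffAt (mem_chartDom_self w) hws)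
    (hZ.contMDiffAt (mem_chartDom_self w) hws)

end

/-! ### Connections in coordinates -/

lemma fibreId_toModel (u : TangentBundle 𝓘(ℝ, E) M) (v : PiTM E M u) :
    fibreId u (toModel u u v) = v :=
  toModel_fibreId u u.2 v

lemma mdifferentiableAt_piField_iff {Y : Π u : TangentBundle 𝓘(ℝ, E) M, PiTM E M u}
    {u : TangentBundle 𝓘(ℝ, E) M} :
    MDifferentiableAt 𝓘(ℝ, E).tangent (𝓘(ℝ, E).tangent.prod 𝓘(ℝ, E))
      (fun q ↦ (⟨q, Y q⟩ : TotalSpace E (PiTM E M))) u ↔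
    MDifferentiableAt 𝓘(ℝ, E).tangent 𝓘(ℝ, E) (fun q ↦ toModel u q (Y q)) u := by
  rw [mdifferentiableAt_section]
  refine Filter.EventuallyEq.mdifferentiableAt_iff ?_
  filter_upwards [chartDom_mem_nhds u] with q hq
  exact (toModel_apply hq (Y q)).symm

/-- The difference of two covariant derivatives is tensorial. -/
lemma tensorialAt_sub {D D' : PreConnection E M}
    (hD : IsCovariantDerivativeOn E D (slit E M)) (hD' : IsCovariantDerivativeOn E D' (slit E M))
    {u : TangentBundle 𝓘(ℝ, E) M} (hu : u ∈ slit E M) :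
    TensorialAt 𝓘(ℝ, E).tangent E (fun Y ↦ D' Y u - D Y u) u where
  smul hf hY := by
    simp only [hD.leibniz hY hf hu, hD'.leibniz hY hf hu, smul_sub]
    abel
  add hY hZ := by
    simp only [hD.add hY hZ hu, hD'.add hY hZ hu]
    abel

/-- The derivative of a section of the pullback bundle in the coordinates of the chart at `u`. -/
def flatDeriv (u : TangentBundle 𝓘(ℝ, E) M) (Y : Π u : TangentBundle 𝓘(ℝ, E) M, PiTM E M u) :
    TangentSpace 𝓘(ℝ, E).tangent u →L[ℝ] PiTM E M u :=
  (fibreId u).comp (mvfderiv 𝓘(ℝ, E).tangent (fun q ↦ toModel u q (Y q)) u)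

/-- `flatDeriv` satisfies the Leibniz rule of a connection at `u`; the difference is the Christoffel
tensor of `D` in the chart. -/
lemma tensorialAt_sub_flatDeriv {D : PreConnection E M}
    (hD : IsCovariantDerivativeOn E D (slit E M))
    {u : TangentBundle 𝓘(ℝ, E) M} (hu : u ∈ slit E M) :
    TensorialAt 𝓘(ℝ, E).tangent E (fun Y ↦ D Y u - flatDeriv u Y) u where
  smul {f Y} hf hY := by
    have h1 : flatDeriv u (f • Y)
        = f u • flatDeriv u Y + (mvfderiv 𝓘(ℝ, E).tangent f u).smulRight (Y u) := by
      have h2 : (fun q ↦ toModel u q ((f • Y) q)) = fun q ↦ f q • toModel u q (Y q) := by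
        ext1 q; exact map_smul _ _ _
      rw [flatDeriv, h2, mvfderiv_fun_smul hf (mdifferentiableAt_piField_iff.1 hY)]
      ext X
      simp [flatDeriv, fibreId_toModel]
    simp only [hD.leibniz hY hf hu, h1, smul_sub]
    abel
  add {Y Z} hY hZ := by
    have h1 : flatDeriv u (Y + Z) = flatDeriv u Y + flatDeriv u Z := by
      have h2 : (fun q ↦ toModel u q ((Y + Z) q))
          = fun q ↦ toModel u q (Y q) + toModel u q (Z q) := by
        ext1 q; exact map_add _ _ _
      rw [flatDeriv, h2, mvfderiv_fun_add (mdifferentiableAt_piField_iff.1 hY)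
        (mdifferentiableAt_piField_iff.1 hZ), ContinuousLinearMap.comp_add]
      rfl
    simp only [hD.add hY hZ hu, h1]
    abel

variable [FiniteDimensional ℝ E] [T2Space M]

/-- A global section of the pullback bundle with value `v` at `u`, whose coordinates in the chart
at `π u` are constant near `u`. -/
def coordField (u : TangentBundle 𝓘(ℝ, E) M) (v : PiTM E M u) :
    Π w : TangentBundle 𝓘(ℝ, E) M, PiTM E M w :=
  frame u (toModel u u v)

lemma isSmoothPiField_coordField (u : TangentBundle 𝓘(ℝ, E) M) (v : PiTM E M u) :
    IsSmoothPiField (coordField u v) :=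
  isSmoothPiField_frame u _

omit [T2Space M] in
@[simp]
lemma coordField_self (u : TangentBundle 𝓘(ℝ, E) M) (v : PiTM E M u) : coordField u v u = v :=
  (frame_self u _).trans (fibreId_toModel u v)

omit [T2Space M] in
lemma coordField_eventuallyEq (u : TangentBundle 𝓘(ℝ, E) M) (v : PiTM E M u) :
    ∀ᶠ w in 𝓝 u, coordField u v w = ofModel u w (toModel u u v) :=
  frame_eventuallyEq_self u _

omit [T2Space M] in
lemma flatDeriv_coordField (u : TangentBundle 𝓘(ℝ, E) M) (v : PiTM E M u) :
    flatDeriv u (coordField u v) = 0 := by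
  have h1 : HasMFDerivAt 𝓘(ℝ, E).tangent 𝓘(ℝ, E) (fun q ↦ toModel u q (coordField u v q)) u 0 := by
    refine (hasMFDerivAt_const (toModel u u v) u).congr_of_eventuallyEq ?_
    filter_upwards [coordField_eventuallyEq u v, chartDom_mem_nhds u] with q hq hqd
    rw [hq, toModel_ofModel hqd]
  rw [flatDeriv, mvfderiv, h1.mfderiv]
  ext X
  simp

/-- A covariant derivative in terms of its values on coordinate fields. -/
lemma cov_eq_flatDeriv_add {D : PreConnection E M}
    (hD : IsCovariantDerivativeOn E D (slit E M))
    {u : TangentBundle 𝓘(ℝ, E) M} (hu : u ∈ slit E M)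
    {Y : Π u : TangentBundle 𝓘(ℝ, E) M, PiTM E M u} (hY : IsSmoothPiField Y) :
    D Y u = flatDeriv u Y + D (coordField u (Y u)) u := by
  have h := (tensorialAt_sub_flatDeriv hD hu).pointwise (hY.mdifferentiableAt hu)
    ((isSmoothPiField_coordField u (Y u)).mdifferentiableAt hu) (coordField_self u (Y u)).symm
  rw [flatDeriv_coordField, sub_zero] at h
  rw [← h]; abel

lemma cov_sub_cov_eq {D D' : PreConnection E M}
    (hD : IsCovariantDerivativeOn E D (slit E M)) (hD' : IsCovariantDerivativeOn E D' (slit E M))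
    {u : TangentBundle 𝓘(ℝ, E) M} (hu : u ∈ slit E M)
    {Y : Π u : TangentBundle 𝓘(ℝ, E) M, PiTM E M u}
    (hY : MDifferentiableAt 𝓘(ℝ, E).tangent (𝓘(ℝ, E).tangent.prod 𝓘(ℝ, E))
      (fun q ↦ (⟨q, Y q⟩ : TotalSpace E (PiTM E M))) u) :
    D' Y u - D Y u = D' (coordField u (Y u)) u - D (coordField u (Y u)) u :=
  (tensorialAt_sub hD hD' hu).pointwise hY
    ((isSmoothPiField_coordField u (Y u)).mdifferentiableAt hu) (coordField_self u (Y u)).symm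

/-! ### Regular connections and their torsion -/

omit [FiniteDimensional ℝ E] [T2Space M] in
lemma IsRegular.exists_horizontal {D : PreConnection E M} (hD : IsRegular D)
    {u : TangentBundle 𝓘(ℝ, E) M} (hu : u ∈ slit E M) (v : PiTM E M u) :
    ∃ X ∈ (horizontal D u : Set (TangentSpace 𝓘(ℝ, E).tangent u)), rho u X = v := by
  obtain ⟨X, hX⟩ := rho_surjective u v
  obtain ⟨Y, hY, Z, hZ, rfl⟩ :=
    Submodule.mem_sup.1 ((hD u hu).sup_eq_top ▸ Submodule.mem_top (x := X))
  refine ⟨Z, hZ, ?_⟩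
  have hY' : rho u Y = 0 := hY
  rw [← hX, map_add, hY', zero_add]

omit [FiniteDimensional ℝ E] [T2Space M] in
lemma IsRegular.rho_beta {D : PreConnection E M} (hD : IsRegular D)
    {u : TangentBundle 𝓘(ℝ, E) M} (hu : u ∈ slit E M) (v : PiTM E M u) :
    rho u (beta D u v) = v :=
  Function.invFunOn_eq (hD.exists_horizontal hu v)

omit [FiniteDimensional ℝ E] [T2Space M] in
lemma IsRegular.cov_eta_beta {D : PreConnection E M} (hD : IsRegular D)
    {u : TangentBundle 𝓘(ℝ, E) M} (hu : u ∈ slit E M) (v : PiTM E M u) :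
    D eta u (beta D u v) = 0 :=
  Function.invFunOn_mem (hD.exists_horizontal hu v)

-- Two lifts of `v` killed by the connection map differ by a vector both vertical and horizontal.
-- This is how the horizontal map of one connection is recognised in terms of another.
omit [FiniteDimensional ℝ E] [T2Space M] in
lemma IsRegular.eq_beta {D : PreConnection E M} (hD : IsRegular D)
    {u : TangentBundle 𝓘(ℝ, E) M} (hu : u ∈ slit E M) {v : PiTM E M u}
    {X : TangentSpace 𝓘(ℝ, E).tangent u} (h1 : rho u X = v) (h2 : D eta u X = 0) :
    X = beta D u v := by
  rw [← sub_eq_zero]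
  refine Submodule.disjoint_def.1 (hD u hu).disjoint _ ?_ ?_
  · change rho u (X - beta D u v) = 0
    rw [map_sub, h1, hD.rho_beta hu, sub_self]
  · change D eta u (X - beta D u v) = 0
    rw [map_sub, h2, hD.cov_eta_beta hu, sub_self]

lemma cov_rho_beta_coordField {D : PreConnection E M}
    (hD : IsCovariantDerivativeOn E D (slit E M)) (hr : IsRegular D)
    {u : TangentBundle 𝓘(ℝ, E) M} (hu : u ∈ slit E M) (w : PiTM E M u) :
    D (fun q ↦ rho q (beta D q (coordField u w q))) u = D (coordField u w) u := by
  have h1 : ∀ᶠ q in 𝓝 u, rho q (beta D q (coordField u w q)) = coordField u w q := by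
    filter_upwards [isOpen_slit.mem_nhds hu] with q hq using hr.rho_beta hq _
  have h2 := (isSmoothPiField_coordField u w).mdifferentiableAt hu
  refine hD.congr_of_eventuallyEq (h2.congr_of_eventuallyEq ?_) h2 (isOpen_slit.mem_nhds hu) h1
  filter_upwards [h1] with q hq
  rw [hq]

omit [T2Space M] in
lemma rho_beta_coordField_eventuallyEq {D : PreConnection E M} (hr : IsRegular D)
    {u : TangentBundle 𝓘(ℝ, E) M} (hu : u ∈ slit E M) (w : PiTM E M u) :
    ∀ᶠ q in 𝓝 u, rho q (beta D q (coordField u w q)) = ofModel u q (toModel u u w) := by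
  filter_upwards [isOpen_slit.mem_nhds hu, coordField_eventuallyEq u w] with q hq hq'
  rw [hr.rho_beta hq, hq']

/-- Of the three torsion terms, one contains `ρ ∘ γ = 0` and the bracket of the two lifts is
vertical, so a single covariant derivative survives. -/
lemma hhvTorsion_coordField {D : PreConnection E M}
    (hD : IsCovariantDerivativeOn E D (slit E M)) (hr : IsRegular D)
    {u : TangentBundle 𝓘(ℝ, E) M} (hu : u ∈ slit E M) (v w : PiTM E M u) :
    hhvTorsion D (coordField u v) (coordField u w) u = D (coordField u w) u (gamma u v) := by
  have h1 : (fun q ↦ rho q (gamma q (coordField u v q))) = 0 := by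
    ext1 q; exact rho_gamma q _
  have h2 := rho_mlieBracket_eq_zero (V := fun q ↦ gamma q (coordField u v q))
    (W := fun q ↦ beta D q (coordField u w q)) (u := u) (v := 0) (w := toModel u u w)
    (.of_forall fun q ↦ by rw [rho_gamma, map_zero]) (rho_beta_coordField_eventuallyEq hr hu w)
  rw [hhvTorsion, torsion, h1, h2, hD.zero hu, cov_rho_beta_coordField hD hr hu]
  simp

lemma hhTorsion_coordField {D : PreConnection E M}
    (hD : IsCovariantDerivativeOn E D (slit E M)) (hr : IsRegular D)
    {u : TangentBundle 𝓘(ℝ, E) M} (hu : u ∈ slit E M) (v w : PiTM E M u) :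
    hhTorsion D (coordField u v) (coordField u w) u
      = D (coordField u w) u (beta D u v) - D (coordField u v) u (beta D u w) := by
  have h2 := rho_mlieBracket_eq_zero (V := fun q ↦ beta D q (coordField u v q))
    (W := fun q ↦ beta D q (coordField u w q)) (u := u)
    (rho_beta_coordField_eventuallyEq hr hu v) (rho_beta_coordField_eventuallyEq hr hu w)
  rw [hhTorsion, torsion, h2, cov_rho_beta_coordField hD hr hu, cov_rho_beta_coordField hD hr hu]
  simp

/-! ### The vertical part of the Cartan connection -/

section Cartan

variable {L : TangentBundle 𝓘(ℝ, E) M → ℝ} {D : PreConnection E M}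

omit [FiniteDimensional ℝ E] [T2Space M] in
/-- Vectors are determined by their products. -/
lemma IsFinsler.eq_zero_of_metric (hL : IsFinsler L) {u : TangentBundle 𝓘(ℝ, E) M}
    (hu : u ∈ slit E M) {v : PiTM E M u} (h : ∀ w, metric L u v w = 0) : v = 0 := by
  by_contra hv
  exact (hL.posDef u hu v hv).ne' (h v)

lemma IsFinsler.mvfderiv_metric_coordField_gamma (hL : IsFinsler L) {u : TangentBundle 𝓘(ℝ, E) M}
    (hu : u ∈ slit E M) (a b c : PiTM E M u) :
    mvfderiv 𝓘(ℝ, E).tangent (fun q ↦ metric L q (coordField u b q) (coordField u c q)) u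
      (gamma u a) = cartanTensor L u (toModel u u a) (toModel u u b) (toModel u u c) := by
  have h1 := hasFDerivAt_comp_fibreIncl ((hL.contMDiffAt_metric_of_isSmoothPiField hu
    (isSmoothPiField_coordField u b) (isSmoothPiField_coordField u c)).mdifferentiableAt (by simp))
  have h2 := hL.hasFDerivAt_metric hu (toModel u u b) (toModel u u c)
  have h3 : (fun q ↦ metric L q (coordField u b q) (coordField u c q)) ∘ fibreIncl u.proj
      = fun y ↦ fderiv ℝ (fderiv ℝ (fibreEnergy L u.proj)) y (toModel u u b) (toModel u u c) := by
    ext1 y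
    simp only [Function.comp_apply, coordField, frame_fibre]
    rfl
  rw [h3] at h1
  have h4 := DFunLike.congr_fun (h1.unique h2) (toModel u u a)
  rw [ContinuousLinearMap.comp_apply, ContinuousLinearMap.comp_apply, fibreId_toModel] at h4
  exact h4

variable (hL : IsFinsler L) (hD : IsCartanConnection L D)
include hL hD

/-- Metricity writes the derivative as a sum of two terms, and the symmetry of the (h)hv-torsion
makes them equal. -/
lemma IsCartanConnection.two_mul_metric_gamma {u : TangentBundle 𝓘(ℝ, E) M}
    (hu : u ∈ slit E M) (a b c : PiTM E M u) :
    2 * metric L u (D (coordField u b) u (gamma u a)) c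
      = mvfderiv 𝓘(ℝ, E).tangent (fun q ↦ metric L q (coordField u b q) (coordField u c q)) u
      (gamma u a) := by
  have h1 := hD.isMetric _ _ (isSmoothPiField_coordField u b) (isSmoothPiField_coordField u c) u hu
    (gamma u a)
  have h2 := hD.hhvTorsion_symm _ _ _ (isSmoothPiField_coordField u a)
    (isSmoothPiField_coordField u b) (isSmoothPiField_coordField u c) u hu
  rw [hhvTorsion_coordField hD.isConnection.isCovariantDerivativeOn hD.isRegular hu,
    hhvTorsion_coordField hD.isConnection.isCovariantDerivativeOn hD.isRegular hu,
    coordField_self, coordField_self] at h2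
  rw [h1, coordField_self, coordField_self, h2, hL.metric_symm hu b, two_mul]

lemma IsCartanConnection.two_mul_metric_gamma_eq {u : TangentBundle 𝓘(ℝ, E) M}
    (hu : u ∈ slit E M) (a b c : PiTM E M u) :
    2 * metric L u (D (coordField u b) u (gamma u a)) c
      = cartanTensor L u (toModel u u a) (toModel u u b) (toModel u u c) := by
  rw [hD.two_mul_metric_gamma hL hu, hL.mvfderiv_metric_coordField_gamma hu]

lemma IsCartanConnection.metric_gamma_swap_left {u : TangentBundle 𝓘(ℝ, E) M}
    (hu : u ∈ slit E M) (a b c : PiTM E M u) :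
    metric L u (D (coordField u b) u (gamma u a)) c
      = metric L u (D (coordField u a) u (gamma u b)) c := by
  have h1 := hD.two_mul_metric_gamma_eq hL hu a b c
  rw [hL.cartanTensor_swap_left hu, ← hD.two_mul_metric_gamma_eq hL hu] at h1
  linarith

lemma IsCartanConnection.metric_gamma_swap_right {u : TangentBundle 𝓘(ℝ, E) M}
    (hu : u ∈ slit E M) (a b c : PiTM E M u) :
    metric L u (D (coordField u b) u (gamma u a)) c
      = metric L u (D (coordField u c) u (gamma u a)) b := by
  have h1 := hD.two_mul_metric_gamma_eq hL hu a b c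
  rw [hL.cartanTensor_swap_right hu, ← hD.two_mul_metric_gamma_eq hL hu] at h1
  linarith

/-- Homogeneity: the Cartan tensor vanishes when an argument is `η`. -/
lemma IsCartanConnection.cov_coordField_gamma_eta {u : TangentBundle 𝓘(ℝ, E) M}
    (hu : u ∈ slit E M) (b : PiTM E M u) :
    D (coordField u b) u (gamma u (eta u)) = 0 := by
  refine hL.eq_zero_of_metric hu fun c ↦ ?_
  have h1 := hD.two_mul_metric_gamma_eq hL hu (eta u) b c
  rw [toModel_eta_self, hL.cartanTensor_eta hu] at h1
  linarith

lemma IsCartanConnection.cov_coordField_eta_gamma {u : TangentBundle 𝓘(ℝ, E) M}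
    (hu : u ∈ slit E M) (b : PiTM E M u) :
    D (coordField u (eta u)) u (gamma u b) = 0 := by
  refine hL.eq_zero_of_metric hu fun c ↦ ?_
  rw [hD.metric_gamma_swap_left hL hu, hD.cov_coordField_gamma_eta hL hu, map_zero]
  rfl

/-- The Cartan connection map is a left inverse of the vertical lift. -/
lemma IsCartanConnection.cov_eta_gamma {u : TangentBundle 𝓘(ℝ, E) M}
    (hu : u ∈ slit E M) (v : PiTM E M u) : D eta u (gamma u v) = v := by
  rw [cov_eq_flatDeriv_add hD.isConnection.isCovariantDerivativeOn hu isSmoothPiField_eta,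
    add_apply, hD.cov_coordField_eta_gamma hL hu, add_zero]
  have h1 : HasMFDerivAt 𝓘(ℝ, E).tangent 𝓘(ℝ, E × E) (extChartAt 𝓘(ℝ, E).tangent u) u
    (chartDeriv u u) := (mdifferentiableAt_extChartAt_tangent (mem_chartDom_self u)).hasMFDerivAt
  have h2 : HasMFDerivAt 𝓘(ℝ, E × E) 𝓘(ℝ, E) (Prod.snd : E × E → E)
      (extChartAt 𝓘(ℝ, E).tangent u u) (ContinuousLinearMap.snd ℝ E E) :=
    (ContinuousLinearMap.snd ℝ E E).hasMFDerivAt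
  have h3 : HasMFDerivAt 𝓘(ℝ, E).tangent 𝓘(ℝ, E) (fun q ↦ toModel u q (eta q)) u
      ((ContinuousLinearMap.snd ℝ E E).comp (chartDeriv u u)) := by
    refine (h2.comp u h1).congr_of_eventuallyEq ?_
    filter_upwards [chartDom_mem_nhds u] with q hq
    exact (congrArg Prod.snd (extChartAt_tangent_apply hq)).symm
  have h4 : flatDeriv u eta (gamma u v) = fibreId u (chartDeriv u u (gamma u v)).2 := by
    rw [flatDeriv, mvfderiv, h3.mfderiv]
    rfl
  rw [h4, chartDeriv_gamma (mem_chartDom_self u), fibreId_toModel]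

omit hL in
lemma IsCartanConnection.cov_coordField_beta {u : TangentBundle 𝓘(ℝ, E) M}
    (hu : u ∈ slit E M) (v w : PiTM E M u) :
    D (coordField u w) u (beta D u v) = D (coordField u v) u (beta D u w) := by
  have h := hD.hhTorsion_eq_zero _ _ (isSmoothPiField_coordField u v)
    (isSmoothPiField_coordField u w) u hu
  rw [hhTorsion_coordField hD.isConnection.isCovariantDerivativeOn hD.isRegular hu] at h
  exact sub_eq_zero.1 h

end Cartan

/-! ### Functions in charts -/

omit [FiniteDimensional ℝ E] [T2Space M] in
lemma mvfderiv_eq_fderiv_chart {F : TangentBundle 𝓘(ℝ, E) M → ℝ} {u q : TangentBundle 𝓘(ℝ, E) M}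
    (hq : q ∈ chartDom E M u) (hF : ContMDiffAt 𝓘(ℝ, E).tangent 𝓘(ℝ, ℝ) ∞ F q)
    (X : TangentSpace 𝓘(ℝ, E).tangent q) :
    mvfderiv 𝓘(ℝ, E).tangent F q X
      = fderiv ℝ (F ∘ (extChartAt 𝓘(ℝ, E).tangent u).symm) (extChartAt 𝓘(ℝ, E).tangent u q)
          (chartDeriv u q X) := by
  have h1 : HasMFDerivAt 𝓘(ℝ, E).tangent 𝓘(ℝ, E × E) (extChartAt 𝓘(ℝ, E).tangent u) q
    (chartDeriv u q) := (mdifferentiableAt_extChartAt_tangent hq).hasMFDerivAt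
  have h2 := ((contDiffAt_comp_extChartAt_symm hq hF).differentiableAt
    (by simp)).hasFDerivAt.hasMFDerivAt
  have h3 : HasMFDerivAt 𝓘(ℝ, E).tangent 𝓘(ℝ, ℝ) F q
      ((fderiv ℝ (F ∘ (extChartAt 𝓘(ℝ, E).tangent u).symm)
        (extChartAt 𝓘(ℝ, E).tangent u q)).comp (chartDeriv u q)) := by
    refine (h2.comp q h1).congr_of_eventuallyEq ?_
    filter_upwards [(isOpen_chartDom u).mem_nhds hq] with p hp
    simp only [Function.comp_apply]
    rw [(extChartAt 𝓘(ℝ, E).tangent u).left_inv (by rwa [extChartAt_tangent_source])]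
  rw [mvfderiv, h3.mfderiv]
  rfl

omit [FiniteDimensional ℝ E] [T2Space M] in
/-- If the derivative of a function only depends on the projection `ρ X` of the tangent vector `X`,
its partial derivatives along `M` have vanishing vertical derivatives. -/
lemma mvfderiv_gamma_eq_zero_of_mvfderiv_eq {P : TangentBundle 𝓘(ℝ, E) M → ℝ}
    (hP : ∀ q ∈ slit E M, ContMDiffAt 𝓘(ℝ, E).tangent 𝓘(ℝ, ℝ) ∞ P q)
    {α : Π q : TangentBundle 𝓘(ℝ, E) M, PiTM E M q →L[ℝ] ℝ}
    (hα : ∀ q ∈ slit E M, ∀ X, mvfderiv 𝓘(ℝ, E).tangent P q X = α q (rho q X))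
    {u : TangentBundle 𝓘(ℝ, E) M} (hu : u ∈ slit E M) (v : E) (b : PiTM E M u)
    (hs : ContMDiffAt 𝓘(ℝ, E).tangent 𝓘(ℝ, ℝ) ∞ (fun q ↦ α q (ofModel u q v)) u) :
    mvfderiv 𝓘(ℝ, E).tangent (fun q ↦ α q (ofModel u q v)) u (gamma u b) = 0 := by
  have hu' := mem_chartDom_self u
  set Φ := extChartAt 𝓘(ℝ, E).tangent u with hΦ
  set P' : E × E → ℝ := P ∘ Φ.symm with hP'
  have hc : ContDiffAt ℝ ∞ P' (Φ u) := contDiffAt_comp_extChartAt_symm hu' (hP u hu)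
  -- In the chart, the hypothesis says that the differential of `P` sees only the `M`-component of a
  -- vector.
  have hev : ∀ᶠ p in 𝓝 (Φ u), ∀ k : E × E,
      fderiv ℝ P' p k = α (Φ.symm p) (ofModel u (Φ.symm p) k.1) := by
    have hT : ∀ᶠ p : E × E in 𝓝 (Φ u), p ∈ Φ.target := extChartAt_target_mem_nhds u
    have hS : ∀ᶠ p : E × E in 𝓝 (Φ u), Φ.symm p ∈ slit E M := by
      refine (continuousAt_extChartAt_symm (I := 𝓘(ℝ, E).tangent) u).eventually ?_
      rw [extChartAt_to_inv]
      exact isOpen_slit.mem_nhds hu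
    filter_upwards [hT, hS] with p hp hps k
    have hqd : Φ.symm p ∈ chartDom E M u := by
      rw [← extChartAt_tangent_source]; exact Φ.map_target hp
    obtain ⟨X, hX⟩ := (chartDeriv_isInvertible hqd).bijective.2 k
    have h1 := mvfderiv_eq_fderiv_chart hqd (hP _ hps) X
    rw [hX, Φ.right_inv hp, hα _ hps] at h1
    have h2 := chartDeriv_fst hqd X
    rw [hX] at h2
    rw [← h1, h2, ofModel_toModel hqd]
  have hd : DifferentiableAt ℝ (fderiv ℝ P') (Φ u) :=
    (hc.fderiv_right (m := ∞) (by simp)).differentiableAt (by simp)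
  have happ : ∀ k l : E × E, fderiv ℝ (fderiv ℝ P') (Φ u) l k
      = fderiv ℝ (fun p ↦ fderiv ℝ P' p k) (Φ u) l := by
    intro k l
    rw [fderiv_clm_apply hd (differentiableAt_const k)]
    simp
  -- The mixed second derivatives agree; the one taken along the fibre first is zero, since the
  -- fibre derivative vanishes near `Φ u`.
  have hsymm := (hc.isSymmSndFDerivAt minSmoothness_le_infty).eq (0, toModel u u b) (v, 0)
  rw [happ, happ] at hsymm
  have h1 : (fun p ↦ fderiv ℝ P' p (v, 0)) =ᶠ[𝓝 (Φ u)] (fun q ↦ α q (ofModel u q v)) ∘ Φ.symm := by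
    filter_upwards [hev] with p hp
    exact hp (v, 0)
  have h2 : (fun p ↦ fderiv ℝ P' p (0, toModel u u b)) =ᶠ[𝓝 (Φ u)] fun _ ↦ 0 := by
    filter_upwards [hev] with p hp
    rw [hp, map_zero, map_zero]
  rw [h1.fderiv_eq, h2.fderiv_eq] at hsymm
  rw [mvfderiv_eq_fderiv_chart hu' hs, chartDeriv_gamma hu', hsymm]
  simp

/-! ### Concurrent fields -/

/-- The Hessian of `β² / 2` is `dβ ⊗ dβ + β · Hess β`, and the second term drops out on the given
pair. -/
lemma fderiv_fderiv_add_half_sq {V : Type*} [NormedAddCommGroup V] [NormedSpace ℝ V]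
    {f h β : V → ℝ} {y : V} (hf : f =ᶠ[𝓝 y] fun z ↦ h z + 1 / 2 * β z ^ 2)
    (hh : ContDiffAt ℝ ∞ h y) (hβ : ContDiffAt ℝ ∞ β y) (v w : V)
    (hβ2 : fderiv ℝ (fderiv ℝ β) y v w = 0) :
    fderiv ℝ (fderiv ℝ f) y v w
      = fderiv ℝ (fderiv ℝ h) y v w + fderiv ℝ β y v * fderiv ℝ β y w := by
  have h1 : fderiv ℝ f =ᶠ[𝓝 y] fun z ↦ fderiv ℝ h z + β z • fderiv ℝ β z := by
    filter_upwards [hf.eventuallyEq_nhds, (hh.of_le two_le_infty).eventually (by simp),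
      (hβ.of_le two_le_infty).eventually (by simp)] with z hz hhz hβz
    have hd1 := (hhz.differentiableAt (by simp)).hasFDerivAt
    have hd2 := (hβz.differentiableAt (by simp)).hasFDerivAt
    have hd : HasFDerivAt (fun z ↦ h z + 1 / 2 * β z ^ 2) _ z :=
      hd1.add ((hd2.pow 2).const_mul (1 / 2))
    rw [hz.fderiv_eq, hd.fderiv]
    ext a
    simp
    ring
  have hd1 : DifferentiableAt ℝ (fderiv ℝ h) y :=
    (hh.fderiv_right (m := ∞) (by simp)).differentiableAt (by simp)
  have hd2 : DifferentiableAt ℝ (fderiv ℝ β) y :=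
    (hβ.fderiv_right (m := ∞) (by simp)).differentiableAt (by simp)
  have hd3 : DifferentiableAt ℝ β y := hβ.differentiableAt (by simp)
  have hd : HasFDerivAt (fun z ↦ fderiv ℝ h z + β z • fderiv ℝ β z) _ y :=
    hd1.hasFDerivAt.add (hd3.hasFDerivAt.smul hd2.hasFDerivAt)
  rw [h1.fderiv_eq, hd.fderiv]
  simp [hβ2]

omit [FiniteDimensional ℝ E] [T2Space M] in
lemma mvfderiv_congr {F G : TangentBundle 𝓘(ℝ, E) M → ℝ} {u : TangentBundle 𝓘(ℝ, E) M}
    (h : F =ᶠ[𝓝 u] G) (X : TangentSpace 𝓘(ℝ, E).tangent u) :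
    mvfderiv 𝓘(ℝ, E).tangent F u X = mvfderiv 𝓘(ℝ, E).tangent G u X := by
  rw [mvfderiv, mvfderiv, h.mfderiv_eq]
  rfl

section Concurrent

variable {L : TangentBundle 𝓘(ℝ, E) M → ℝ} {D : PreConnection E M}
  {ζ : Π u : TangentBundle 𝓘(ℝ, E) M, PiTM E M u}
  (hL : IsFinsler L) (hD : IsCartanConnection L D) (hζ : IsConcurrent D ζ)
include hL hD hζ

omit hL in
lemma IsConcurrent.mvfderiv_metric_coordField {u : TangentBundle 𝓘(ℝ, E) M} (hu : u ∈ slit E M)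
    (v : PiTM E M u) (X : TangentSpace 𝓘(ℝ, E).tangent u) :
    mvfderiv 𝓘(ℝ, E).tangent (fun q ↦ metric L q (ζ q) (coordField u v q)) u X
      = - metric L u (rho u X) v + metric L u (ζ u) (D (coordField u v) u X) := by
  rw [hD.isMetric _ _ hζ.smooth (isSmoothPiField_coordField u v) u hu X, hζ.cov_eq u hu,
    coordField_self, map_neg]
  rfl

/-- The fibre derivatives of the components of the `1`-form `g(ζ, ·)` vanish. -/
lemma IsConcurrent.mvfderiv_metric_coordField_gamma {u : TangentBundle 𝓘(ℝ, E) M}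
    (hu : u ∈ slit E M) (v b : PiTM E M u) :
    mvfderiv 𝓘(ℝ, E).tangent (fun q ↦ metric L q (ζ q) (coordField u v q)) u (gamma u b) = 0 := by
  have hs : ContMDiffAt 𝓘(ℝ, E).tangent 𝓘(ℝ, ℝ) ∞
      (fun q ↦ metric L q (ζ q) (coordField u v q)) u :=
    hL.contMDiffAt_metric_of_isSmoothPiField hu hζ.smooth (isSmoothPiField_coordField u v)
  have hev : (fun q ↦ ((-2 : ℝ) • metric L q (ζ q)) (ofModel u q (toModel u u v))) =ᶠ[𝓝 u]
      fun q ↦ (-2 : ℝ) * metric L q (ζ q) (coordField u v q) := by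
    filter_upwards [coordField_eventuallyEq u v] with q hq
    rw [hq]
    rfl
  have hs' : ContMDiffAt 𝓘(ℝ, E).tangent 𝓘(ℝ, ℝ) ∞
      (fun q ↦ (-2 : ℝ) * metric L q (ζ q) (coordField u v q)) u :=
    contMDiffAt_const.mul hs
  -- Here `P = p²`: metricity and `D_X ζ = -ρX` give `dP(X) = -2 g(ζ, ρX)`.
  have h := mvfderiv_gamma_eq_zero_of_mvfderiv_eq (P := fun q ↦ metric L q (ζ q) (ζ q))
    (fun q hq ↦ hL.contMDiffAt_metric_of_isSmoothPiField hq hζ.smooth hζ.smooth)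
    (α := fun q ↦ (-2 : ℝ) • metric L q (ζ q)) (fun q hq X ↦ by
      rw [hD.isMetric _ _ hζ.smooth hζ.smooth q hq X, hζ.cov_eq q hq, hL.metric_symm hq, map_neg]
      change _ = (-2 : ℝ) * metric L q (ζ q) (rho q X)
      ring) hu (toModel u u v) b (hs'.congr_of_eventuallyEq hev)
  rw [mvfderiv_congr hev, mvfderiv_fun_mul mdifferentiableAt_const
    (hs.mdifferentiableAt (by simp))] at h
  simpa [mvfderiv_const] using h

/-- The `(h)hv`-torsion is orthogonal to a concurrent field. -/
lemma IsConcurrent.metric_cov_gamma {u : TangentBundle 𝓘(ℝ, E) M}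
    (hu : u ∈ slit E M) (v b : PiTM E M u) :
    metric L u (ζ u) (D (coordField u v) u (gamma u b)) = 0 := by
  have h := hζ.mvfderiv_metric_coordField_gamma hL hD hu v b
  rw [hζ.mvfderiv_metric_coordField hD hu, rho_gamma, map_zero] at h
  simpa using h

/-- Total symmetry moves `ζ` from the direction slot to the slot where
`IsConcurrent.metric_cov_gamma` applies. -/
lemma IsConcurrent.cov_coordField_gamma {u : TangentBundle 𝓘(ℝ, E) M}
    (hu : u ∈ slit E M) (v : PiTM E M u) : D (coordField u v) u (gamma u (ζ u)) = 0 := by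
  refine hL.eq_zero_of_metric hu fun c ↦ ?_
  rw [hD.metric_gamma_swap_left hL hu, hD.metric_gamma_swap_right hL hu, hL.metric_symm hu,
    hζ.metric_cov_gamma hL hD hu]

/-- The metric of the changed Finsler structure. -/
lemma IsConcurrent.metric_eq {L' : TangentBundle 𝓘(ℝ, E) M → ℝ}
    (hLL' : ∀ u ∈ slit E M, L' u ^ 2 = L u ^ 2 + metric L u (ζ u) (eta u) ^ 2)
    {u : TangentBundle 𝓘(ℝ, E) M} (hu : u ∈ slit E M) (v w : PiTM E M u) :
    metric L' u v w = metric L u v w + metric L u (ζ u) v * metric L u (ζ u) w := by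
  set B : TangentBundle 𝓘(ℝ, E) M → ℝ := fun q ↦ metric L q (ζ q) (eta q) with hB
  set x := u.proj
  have hBs : ∀ q ∈ slit E M, ContMDiffAt 𝓘(ℝ, E).tangent 𝓘(ℝ, ℝ) ∞ B q := fun q hq ↦
    hL.contMDiffAt_metric_of_isSmoothPiField hq hζ.smooth isSmoothPiField_eta
  -- A vertical derivative does not see `ζ`, because `D_{γb} ζ = -ρ(γb) = 0`, while `D_{γb} η = b`.
  have hB1 : ∀ q ∈ slit E M, ∀ b, mvfderiv 𝓘(ℝ, E).tangent B q (gamma q b)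
      = metric L q (ζ q) b := by
    intro q hq b
    rw [hD.isMetric _ _ hζ.smooth isSmoothPiField_eta q hq, hζ.cov_eq q hq, rho_gamma, neg_zero,
      map_zero, hD.cov_eta_gamma hL hq]
    simp
  have hβ1 : ∀ y : E, y ≠ 0 → ∀ b, fderiv ℝ (B ∘ fibreIncl x) y b
      = metric L (fibreIncl x y) (ζ (fibreIncl x y)) (fibreId (fibreIncl x y) b) := by
    intro y hy b
    have hq : (fibreIncl x y : TangentBundle 𝓘(ℝ, E) M) ∈ slit E M := hy
    have h := (hasFDerivAt_comp_fibreIncl ((hBs _ hq).mdifferentiableAt (by simp))).fderiv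
    exact (DFunLike.congr_fun h b).trans (hB1 _ hq _)
  have hu0 : fibreCoord u ≠ 0 := hu
  have hβs : ContDiffAt ℝ ∞ (B ∘ fibreIncl x) (fibreCoord u) := by
    have : ContMDiffAt 𝓘(ℝ, E) 𝓘(ℝ, ℝ) ∞ (B ∘ fibreIncl x) (fibreCoord u) :=
      ContMDiffAt.comp (fibreCoord u) (hBs (fibreIncl x (fibreCoord u)) hu)
        (contMDiff_fibreIncl x (fibreCoord u))
    exact this.contDiffAt
  -- The first fibre derivatives of `B` are the components of `g(ζ, ·)`, and these have zero fibre
  -- derivative.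
  have hβ2 : fderiv ℝ (fderiv ℝ (B ∘ fibreIncl x)) (fibreCoord u) (toModel u u v) (toModel u u w)
      = 0 := by
    have hd : DifferentiableAt ℝ (fderiv ℝ (B ∘ fibreIncl x)) (fibreCoord u) :=
      (hβs.fderiv_right (m := ∞) (by simp)).differentiableAt (by simp)
    have h1 : fderiv ℝ (fderiv ℝ (B ∘ fibreIncl x)) (fibreCoord u) (toModel u u v) (toModel u u w)
        = fderiv ℝ (fun y ↦ fderiv ℝ (B ∘ fibreIncl x) y (toModel u u w)) (fibreCoord u)
          (toModel u u v) := by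
      rw [fderiv_clm_apply hd (differentiableAt_const _)]
      simp
    have h2 : (fun y ↦ fderiv ℝ (B ∘ fibreIncl x) y (toModel u u w)) =ᶠ[𝓝 (fibreCoord u)]
        (fun q ↦ metric L q (ζ q) (coordField u w q)) ∘ fibreIncl x := by
      filter_upwards [isOpen_ne.mem_nhds hu0] with y hy
      rw [hβ1 y hy, Function.comp_apply, coordField, frame_fibre]
    have h3 := (hasFDerivAt_comp_fibreIncl ((hL.contMDiffAt_metric_of_isSmoothPiField hu
      hζ.smooth (isSmoothPiField_coordField u w)).mdifferentiableAt (by simp))).fderiv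
    rw [h1, h2.fderiv_eq, h3]
    exact hζ.mvfderiv_metric_coordField_gamma hL hD hu w _
  have hf : fibreEnergy L' x =ᶠ[𝓝 (fibreCoord u)]
      fun y ↦ fibreEnergy L x y + 1 / 2 * (B ∘ fibreIncl x) y ^ 2 := by
    filter_upwards [isOpen_ne.mem_nhds hu0] with y hy
    rw [fibreEnergy, fibreEnergy, hLL' _ hy]
    simp only [Function.comp_apply, hB]
    ring
  have h := fderiv_fderiv_add_half_sq hf (hL.contDiffAt_fibreEnergy x hu0) hβs _ _ hβ2
  rw [hβ1 _ hu0, hβ1 _ hu0] at h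
  have hv := fibreId_toModel u v
  have hw := fibreId_toModel u w
  calc metric L' u v w = metric L' u (fibreId u (toModel u u v)) (fibreId u (toModel u u w)) := by
        rw [hv, hw]
    _ = metric L u (fibreId u (toModel u u v)) (fibreId u (toModel u u w))
        + metric L u (ζ u) (fibreId u (toModel u u v))
          * metric L u (ζ u) (fibreId u (toModel u u w)) := h
    _ = _ := by rw [hv, hw]

end Concurrent

/-! ### Uniqueness of the Cartan connection, pointwise -/

/-- A tensor which is skew-symmetric for a metric, and whose torsion is the one of the difference of
two Cartan connections with the same vertical part, vanishes. -/
lemma eq_zero_of_skew_of_torsion {V : Type*} [AddCommGroup V] [Module ℝ V] (g : V →ₗ[ℝ] V →ₗ[ℝ] ℝ)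
    (hg : ∀ v, v ≠ 0 → 0 < g v v) (a T : V → V → V) (η : V)
    (hT : ∀ v w z, g (T v w) z = g (T v z) w)
    (hT0 : ∀ w, T 0 w = 0)
    (hTη : ∀ v, T v η = 0)
    (ha : ∀ v w z, g (a v w) z = - g (a v z) w)
    (hτ : ∀ v w, a v w - a w v = T (a v η) w - T (a w η) v) (v w : V) : a v w = 0 := by
  have nondeg : ∀ {v}, (∀ w, g v w = 0) → v = 0 := fun {v} h ↦ by
    by_contra hv
    exact (hg v hv).ne' (h v)
  -- The torsion identity for `(v, η)`, paired with `η`: skewness kills `g(a v η, η)` and `T(·, η) =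
  -- 0` kills the right-hand side.
  have h1 : a η η = 0 := nondeg fun v ↦ by
    have h := congrArg (fun x ↦ g x η) (hτ v η)
    simp only [map_sub, LinearMap.sub_apply, hTη, zero_sub, map_neg, LinearMap.neg_apply] at h
    have e1 := ha v η η
    have e2 := hT (a η η) v η
    rw [hTη] at e2
    have e3 := ha η v η
    simp only [map_zero, LinearMap.zero_apply] at e2
    linarith
  have h2 : ∀ v, a v η = a η v := fun v ↦ by
    have h := hτ v η
    rw [hTη, h1, hT0, sub_zero] at h
    exact sub_eq_zero.1 h
  have h3 : ∀ v w z, g (a v w) z - g (a w v) z = g (T (a v η) w) z - g (T (a w η) v) z := by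
    intro v w z
    have h := congrArg (fun x ↦ g x z) (hτ v w)
    simpa only [map_sub, LinearMap.sub_apply] using h
  -- Paired with `η` the torsion term vanishes, so `g(a η w, z)` is symmetric in `w, z`; it is also
  -- skew.
  have h4 : ∀ w, a η w = 0 := fun w ↦ nondeg fun z ↦ by
    have e1 := h3 w z η
    rw [hT, hTη, hT (a z η), hTη] at e1
    simp only [map_zero, LinearMap.zero_apply] at e1
    have e2 := ha w z η
    have e3 := ha z w η
    rw [h2] at e2 e3
    have e4 := ha η w z
    linarith
  have h5 : ∀ v w z, g (a v w) z = g (a w v) z := fun v w z ↦ by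
    have h := h3 v w z
    rw [h2, h4, h2, h4, hT0, hT0, sub_self] at h
    exact sub_eq_zero.1 h
  refine nondeg fun z ↦ ?_
  have e1 := ha v w z
  have e2 := h5 v z w
  have e3 := ha z v w
  have e4 := h5 z w v
  have e5 := ha w z v
  have e6 := h5 w v z
  linarith

/-! ### The change of the Cartan connection -/

section Change

variable {L L' : TangentBundle 𝓘(ℝ, E) M → ℝ} {D D' : PreConnection E M}
  {ζ : Π u : TangentBundle 𝓘(ℝ, E) M, PiTM E M u}
  (hL : IsFinsler L) (hL' : IsFinsler L') (hD : IsCartanConnection L D)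
  (hD' : IsCartanConnection L' D') (hζ : IsConcurrent D ζ)
  (hLL' : ∀ u ∈ slit E M, L' u ^ 2 = L u ^ 2 + metric L u (ζ u) (eta u) ^ 2)

omit [FiniteDimensional ℝ E] [T2Space M] in
lemma IsFinsler.one_add_metric_pos (hL : IsFinsler L) {u : TangentBundle 𝓘(ℝ, E) M}
    (hu : u ∈ slit E M) (v : PiTM E M u) : 0 < 1 + metric L u v v := by
  by_cases h : v = 0
  · rw [h, map_zero]; simp
  · linarith [hL.posDef u hu v h]

include hL hD hζ hLL' in
-- Product rule for `g' = g + ω ⊗ ω` on chart-constant sections, with `ω` differentiated by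
-- metricity and concurrency.
lemma IsConcurrent.mvfderiv_metric_change {u : TangentBundle 𝓘(ℝ, E) M} (hu : u ∈ slit E M)
    (v w : PiTM E M u) (X : TangentSpace 𝓘(ℝ, E).tangent u) :
    mvfderiv 𝓘(ℝ, E).tangent (fun q ↦ metric L' q (coordField u v q) (coordField u w q)) u X
      = mvfderiv 𝓘(ℝ, E).tangent (fun q ↦ metric L q (coordField u v q) (coordField u w q)) u X
        + (metric L u (ζ u) v
            * (- metric L u (rho u X) w + metric L u (ζ u) (D (coordField u w) u X))
          + metric L u (ζ u) w
            * (- metric L u (rho u X) v + metric L u (ζ u) (D (coordField u v) u X))) := by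
  have hv := isSmoothPiField_coordField u v
  have hw := isSmoothPiField_coordField u w
  have h1 := (hL.contMDiffAt_metric_of_isSmoothPiField hu hv hw).mdifferentiableAt (by simp)
  have h2 := (hL.contMDiffAt_metric_of_isSmoothPiField hu hζ.smooth hv).mdifferentiableAt (by simp)
  have h3 := (hL.contMDiffAt_metric_of_isSmoothPiField hu hζ.smooth hw).mdifferentiableAt (by simp)
  have h23 : MDifferentiableAt 𝓘(ℝ, E).tangent 𝓘(ℝ, ℝ) (fun q ↦ metric L q (ζ q) (coordField u v q)
      * metric L q (ζ q) (coordField u w q)) u := h2.mul h3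
  have hev : (fun q ↦ metric L' q (coordField u v q) (coordField u w q)) =ᶠ[𝓝 u] fun q ↦
      metric L q (coordField u v q) (coordField u w q)
        + metric L q (ζ q) (coordField u v q) * metric L q (ζ q) (coordField u w q) := by
    filter_upwards [isOpen_slit.mem_nhds hu] with q hq
    exact hζ.metric_eq hL hD hLL' hq _ _
  rw [mvfderiv_congr hev, mvfderiv_fun_add h1 h23, mvfderiv_fun_mul h2 h3,
    add_apply, add_apply, smul_apply, smul_apply,
    hζ.mvfderiv_metric_coordField hD hu, hζ.mvfderiv_metric_coordField hD hu, coordField_self,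
    coordField_self, smul_eq_mul, smul_eq_mul]

include hL hL' hD hD' hζ hLL' in
/-- The vertical parts of the two Cartan connections agree. -/
lemma IsConcurrent.cov_coordField_gamma_eq {u : TangentBundle 𝓘(ℝ, E) M} (hu : u ∈ slit E M)
    (v n : PiTM E M u) :
    D' (coordField u v) u (gamma u n) = D (coordField u v) u (gamma u n) := by
  rw [← sub_eq_zero]
  refine hL'.eq_zero_of_metric hu fun c ↦ ?_
  have h1 := hD'.two_mul_metric_gamma hL' hu n v c
  rw [hζ.mvfderiv_metric_change hL hD hLL' hu, ← hD.two_mul_metric_gamma hL hu, rho_gamma,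
    hζ.metric_cov_gamma hL hD hu, hζ.metric_cov_gamma hL hD hu, map_zero] at h1
  have h2 := hζ.metric_eq hL hD hLL' hu (D (coordField u v) u (gamma u n)) c
  rw [hζ.metric_cov_gamma hL hD hu] at h2
  rw [map_sub, sub_apply, h2]
  simp only [zero_apply, neg_zero, add_zero, mul_zero] at h1
  linarith

include hL hL' hD hD' hζ hLL' in
-- A vector splits into a `D`-horizontal lift and a vertical lift. The vertical parts already agree,
-- so only the defect `a` of the formula on horizontal lifts has to vanish.
lemma IsConcurrent.cov_coordField_change {u : TangentBundle 𝓘(ℝ, E) M} (hu : u ∈ slit E M)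
    (w : PiTM E M u) (X : TangentSpace 𝓘(ℝ, E).tangent u) :
    D' (coordField u w) u X = D (coordField u w) u X
      - (metric L u (rho u X) w / (1 + metric L u (ζ u) (ζ u))) • ζ u := by
  set s := 1 + metric L u (ζ u) (ζ u) with hs
  have hspos : 0 < s := hL.one_add_metric_pos hu (ζ u)
  have hdec : ∀ X : TangentSpace 𝓘(ℝ, E).tangent u, ∃ n, X = beta D u (rho u X) + gamma u n := by
    intro X
    obtain ⟨n, hn⟩ := exists_gamma_eq (X := X - beta D u (rho u X))
      (by rw [map_sub, hD.isRegular.rho_beta hu, sub_self])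
    exact ⟨n, by rw [hn]; abel⟩
  set a : PiTM E M u → PiTM E M u → PiTM E M u := fun v w ↦
    D' (coordField u w) u (beta D u v) - D (coordField u w) u (beta D u v)
      + (metric L u v w / s) • ζ u with ha
  have hvert := fun v n ↦ hζ.cov_coordField_gamma_eq hL hL' hD hD' hLL' hu v n
  -- Since `D_{βv} η = 0`, the value `D'_{βv} η` is `a(v, η) - (g(v, η) / s) ζ`. Subtracting its
  -- vertical lift from `βv` gives a `D'`-horizontal vector, because `D'_{γn} η = n`.
  have hβ : ∀ v, beta D' u v
      = beta D u v + gamma u ((metric L u v (eta u) / s) • ζ u - a v (eta u)) := by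
    intro v
    refine (hD'.isRegular.eq_beta hu ?_ ?_).symm
    · rw [map_add, rho_gamma, hD.isRegular.rho_beta hu, add_zero]
    · have h1 := DFunLike.congr_fun (cov_sub_cov_eq hD.isConnection.isCovariantDerivativeOn
        hD'.isConnection.isCovariantDerivativeOn hu (isSmoothPiField_eta.mdifferentiableAt hu))
        (beta D u v)
      rw [sub_apply, sub_apply, hD.isRegular.cov_eta_beta hu, sub_zero] at h1
      rw [map_add, hD'.cov_eta_gamma hL' hu, h1]
      simp only [ha]
      abel
  have hzero : ∀ v w, a v w = 0 := by
    intro v w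
    have hT : ∀ v w z, metric L' u (D (coordField u w) u (gamma u v)) z
        = metric L' u (D (coordField u z) u (gamma u v)) w := by
      intro v w z
      rw [← hvert, ← hvert, hD'.metric_gamma_swap_right hL' hu]
    refine eq_zero_of_skew_of_torsion (V := PiTM E M u)
      (ContinuousLinearMap.coeLM ℝ ∘ₗ (metric L' u).toLinearMap)
      (fun v hv ↦ hL'.posDef u hu v hv) a (fun v w ↦ D (coordField u w) u (gamma u v)) (eta u)
      hT (fun w ↦ ?_) (fun v ↦ hD.cov_coordField_eta_gamma hL hu v) ?_ ?_ v w
    · rw [map_zero, map_zero]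
    · intro v w z
      change metric L' u (a v w) z = - metric L' u (a v z) w
      have h1 := hD'.isMetric _ _ (isSmoothPiField_coordField u w) (isSmoothPiField_coordField u z)
        u hu (beta D u v)
      rw [hζ.mvfderiv_metric_change hL hD hLL' hu, hD.isMetric _ _ (isSmoothPiField_coordField u w)
        (isSmoothPiField_coordField u z) u hu, coordField_self, coordField_self,
        hD.isRegular.rho_beta hu] at h1
      have h2 : ∀ w z, metric L' u (a v w) z = metric L' u (D' (coordField u w) u (beta D u v)) z
          - metric L' u (D (coordField u w) u (beta D u v)) z
          + metric L u v w * metric L u (ζ u) z := by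
        intro w z
        simp only [ha]
        rw [map_add, map_sub, map_smul, add_apply, sub_apply, smul_apply,
          hζ.metric_eq hL hD hLL' hu (ζ u) z, smul_eq_mul]
        -- The relation `g'(ζ, ·) = s ω`: it is what determines the denominator `1 + p²`.
        have : metric L u (ζ u) z + metric L u (ζ u) (ζ u) * metric L u (ζ u) z
            = s * metric L u (ζ u) z := by rw [hs]; ring
        rw [this]
        field_simp
      rw [h2, h2, hζ.metric_eq hL hD hLL' hu (D (coordField u w) u (beta D u v)) z,
        hζ.metric_eq hL hD hLL' hu (D (coordField u z) u (beta D u v)) w,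
        hL'.metric_symm hu (D' (coordField u z) u (beta D u v)) w,
        hL.metric_symm hu (D (coordField u z) u (beta D u v)) w]
      linarith
    · intro v w
      -- The multiple of `ζ` in the vertical correction acts trivially because `D_{γζ}` kills
      -- chart-constant sections; only the part along `a(v, η)` remains. In the torsion identity the
      -- terms symmetric in `v, w` then cancel.
      have h1 : ∀ v w, D' (coordField u w) u (beta D' u v)
          = D (coordField u w) u (beta D u v) - (metric L u v w / s) • ζ u + a v w
            - D (coordField u w) u (gamma u (a v (eta u))) := by
        intro v w
        rw [hβ v, map_add, hvert, map_sub, map_sub, map_smul, map_smul,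
          hζ.cov_coordField_gamma hL hD hu, smul_zero]
        simp only [ha]
        abel
      have h2 := hD'.cov_coordField_beta hu v w
      rw [h1, h1, hD.cov_coordField_beta hu v w, hL.metric_symm hu v w] at h2
      have h3 := sub_eq_zero.2 h2
      rw [← sub_eq_zero, ← h3]
      abel
  obtain ⟨n, hn⟩ := hdec X
  have h1 := hzero (rho u X) w
  simp only [ha] at h1
  have h2 : D' (coordField u w) u X = D' (coordField u w) u (beta D u (rho u X))
      + D' (coordField u w) u (gamma u n) := by rw [← map_add, ← hn]
  have h3 : D (coordField u w) u X = D (coordField u w) u (beta D u (rho u X))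
      + D (coordField u w) u (gamma u n) := by rw [← map_add, ← hn]
  rw [h2, h3, hvert, ← sub_eq_zero, ← h1]
  abel

include hL hL' hD hD' hζ hLL' in
lemma IsConcurrent.cov_change {u : TangentBundle 𝓘(ℝ, E) M} (hu : u ∈ slit E M)
    {Y : Π u : TangentBundle 𝓘(ℝ, E) M, PiTM E M u}
    (hY : MDifferentiableAt 𝓘(ℝ, E).tangent (𝓘(ℝ, E).tangent.prod 𝓘(ℝ, E))
      (fun q ↦ (⟨q, Y q⟩ : TotalSpace E (PiTM E M))) u)
    (X : TangentSpace 𝓘(ℝ, E).tangent u) :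
    D' Y u X = D Y u X
      - (metric L u (rho u X) (Y u) / (1 + metric L u (ζ u) (ζ u))) • ζ u := by
  have h1 := DFunLike.congr_fun (cov_sub_cov_eq hD.isConnection.isCovariantDerivativeOn
    hD'.isConnection.isCovariantDerivativeOn hu hY) X
  rw [sub_apply, sub_apply, hζ.cov_coordField_change hL hL' hD hD' hLL' hu] at h1
  rw [sub_eq_iff_eq_add.1 h1]
  abel

include hL hL' hD hD' hζ hLL' in
lemma IsConcurrent.beta_change {u : TangentBundle 𝓘(ℝ, E) M} (hu : u ∈ slit E M)
    (v : PiTM E M u) :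
    beta D' u v = beta D u v
      + gamma u ((metric L u v (eta u) / (1 + metric L u (ζ u) (ζ u))) • ζ u) := by
  refine (hD'.isRegular.eq_beta hu ?_ ?_).symm
  · rw [map_add, rho_gamma, hD.isRegular.rho_beta hu, add_zero]
  · rw [map_add, hD'.cov_eta_gamma hL' hu, hζ.cov_change hL hL' hD hD' hLL' hu
      (isSmoothPiField_eta.mdifferentiableAt hu), hD.isRegular.cov_eta_beta hu,
      hD.isRegular.rho_beta hu]
    abel

end Change

-- In the chart `ρY` is the first component of the coordinate expression of `Y`.
omit [FiniteDimensional ℝ E] [T2Space M] in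
lemma IsSmoothField.mdifferentiableAt_rho
    {Y : Π u : TangentBundle 𝓘(ℝ, E) M, TangentSpace 𝓘(ℝ, E).tangent u} (hY : IsSmoothField Y)
    {u : TangentBundle 𝓘(ℝ, E) M} (hu : u ∈ slit E M) :
    MDifferentiableAt 𝓘(ℝ, E).tangent (𝓘(ℝ, E).tangent.prod 𝓘(ℝ, E))
      (fun q ↦ (⟨q, rho q (Y q)⟩ : TotalSpace E (PiTM E M))) u := by
  have h1 := ((hY u hu).contMDiffAt (isOpen_slit.mem_nhds hu)).mdifferentiableAt (by simp)
  rw [mdifferentiableAt_section] at h1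
  have h2 : MDifferentiableAt 𝓘(ℝ, E).tangent 𝓘(ℝ, E × E) (fun q ↦ chartDeriv u q (Y q)) u := by
    refine h1.congr_of_eventuallyEq ?_
    filter_upwards [chartDom_mem_nhds u] with q hq
    have hq' : q ∈ (chartAt (ModelProd E E) u).source :=
      (TangentBundle.mem_chart_source_iff (I := 𝓘(ℝ, E)) q u).2 hq
    have h3 := TangentBundle.continuousLinearMapAt_trivializationAt (I := 𝓘(ℝ, E).tangent) hq'
    have h4 := (trivializationAt (E × E)
      (TangentSpace 𝓘(ℝ, E).tangent : TangentBundle 𝓘(ℝ, E) M → Type _) u).coe_linearMapAt_of_mem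
      (R := ℝ) hq'
    exact (DFunLike.congr_fun h3 (Y q)).symm.trans (congrFun h4 (Y q))
  rw [mdifferentiableAt_piField_iff]
  have h5 : MDifferentiableAt 𝓘(ℝ, E).tangent 𝓘(ℝ, E) (fun q ↦ (chartDeriv u q (Y q)).1) u :=
    (ContinuousLinearMap.fst ℝ E E).differentiableAt.comp_mdifferentiableAt h2
  refine h5.congr_of_eventuallyEq ?_
  filter_upwards [chartDom_mem_nhds u] with q hq
  exact (chartDeriv_fst hq (Y q)).symm

end Finsler

end

theorem theorem3
    {E : Type*} [NormedAddCommGroup E] [NormedSpace ℝ E] [FiniteDimensional ℝ E]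
    {M : Type*} [TopologicalSpace M] [T2Space M] [ParacompactSpace M]
    [ChartedSpace E M] [IsManifold 𝓘(ℝ, E) ∞ M]
    (L L' : TangentBundle 𝓘(ℝ, E) M → ℝ)
    (hL : Finsler.IsFinsler L) (hL' : Finsler.IsFinsler L')
    (D D' : Finsler.PreConnection E M)
    (hD : Finsler.IsCartanConnection L D) (hD' : Finsler.IsCartanConnection L' D')
    (ζ : Π u : TangentBundle 𝓘(ℝ, E) M, Finsler.PiTM E M u)
    (hζ : Finsler.IsConcurrent D ζ)
    (hLL' : ∀ u ∈ Finsler.slit E M,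
      L' u ^ 2 = L u ^ 2 + (Finsler.metric L u (ζ u) (Finsler.eta u)) ^ 2) :
    (∀ Y : Π u : TangentBundle 𝓘(ℝ, E) M, TangentSpace 𝓘(ℝ, E).tangent u,
      Finsler.IsSmoothField Y →
      ∀ u ∈ Finsler.slit E M, ∀ X : TangentSpace 𝓘(ℝ, E).tangent u,
        D' (fun w ↦ Finsler.rho w (Y w)) u X
          = D (fun w ↦ Finsler.rho w (Y w)) u X
            - (Finsler.metric L u (Finsler.rho u X) (Finsler.rho u (Y u))
                / (1 + Finsler.metric L u (ζ u) (ζ u))) • ζ u) ∧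
    (∀ Y : Π u : TangentBundle 𝓘(ℝ, E) M, Finsler.PiTM E M u,
      Finsler.IsSmoothPiField Y →
      ∀ u ∈ Finsler.slit E M, ∀ v : Finsler.PiTM E M u,
        D' Y u (Finsler.gamma u v) = D Y u (Finsler.gamma u v)) ∧
    (∀ Y : Π u : TangentBundle 𝓘(ℝ, E) M, Finsler.PiTM E M u,
      Finsler.IsSmoothPiField Y →
      ∀ u ∈ Finsler.slit E M, ∀ v : Finsler.PiTM E M u,
        D' Y u (Finsler.beta D' u v)
          = D Y u (Finsler.beta D u v) - Finsler.horizontalChange L D ζ u v Y) := by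
  refine ⟨fun Y hY u hu X ↦ ?_, fun Y hY u hu v ↦ ?_, fun Y hY u hu v ↦ ?_⟩
  · exact hζ.cov_change hL hL' hD hD' hLL' hu (hY.mdifferentiableAt_rho hu) X
  · rw [hζ.cov_change hL hL' hD hD' hLL' hu (hY.mdifferentiableAt hu), Finsler.rho_gamma]
    simp
  -- The first term of `U` is the change of connection along a lift of `v`. The second comes from
  -- `β'v - βv`, a multiple of `γζ`, along which a general section `Y` need not be parallel.
  · rw [hζ.cov_change hL hL' hD hD' hLL' hu (hY.mdifferentiableAt hu),
      hD'.isRegular.rho_beta hu, hζ.beta_change hL hL' hD hD' hLL' hu, map_add, map_smul, map_smul,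
      Finsler.horizontalChange]
    abel
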